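/- Let $1<\gamma\le 3$ and $k>0$. Consider the one-dimensional Euler equations $$\partial_t(\rho,\rho u,E)+\partial_x\big(\rho u,\ \rho u^2+p,\ (E+p)u\big)=\big(0,0,Q\,\delta(x)\big),\qquad E=\frac{p}{\gamma-1}+\frac{\rho u^2}{2},$$ with constant initial state $U_1=(\rho_1,u_1,p_1)$, $\rho_1,p_1,u_1>0$. Write $a=\sqrt{\gamma p/\rho}$, $M=u/a$, $h=\frac{\gamma}{\gamma-1}\frac{p}{\rho}$. A *solution under the double CRPs frame with heating parameter $k$* is a function $U(x,t)$ with $U(x,0)=U_1$ for which there are constant states $U_\pm$ (positive density and pressure, nonzero velocity) with $U(0\pm,t)=U_\pm$ for all $t>0$, such that: * for $x<0$, $U$ is the left half of a classical self-similar Riemann solution of the homogeneous Euler equations with left and right data $U_1,U_-$, and for $x>0$ it is the right half of one with data $U_+,U_1$ (such a solution consists of a shock or centred rarefaction of the field $u-a$, a contact discontinuity, and a shock or centred rarefaction of the field $u+a$, any of which may be absent; shocks satisfy the Rankine–Hugoniot and Lax conditions, and there is no vacuum); * for some $Q>0$, across $x=0$ one has $\rho_-u_-=\rho_+u_+$, $\rho_-u_-^2+p_-=\rho_+u_+^2+p_+$,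 $(E_-+p_-)u_-+Q=(E_++p_+)u_+$, where $k=Q/\big(\rho|u|(\tfrac12u^2+h)\big)$ evaluated at the upstream state ($U_-$ if $u_->0$, $U_+$ if $u_-<0$); * if the upstream flow at $x=0$ is subsonic ($|M|<1$), the downstream one has $|M|\le1$; if the upstream flow is supersonic ($|M|>1$), the downstream one has $|M|\ge1$. Let $$M_*=\sqrt{\tfrac{k(\gamma+1)+1-(\gamma+1)\sqrt{k(k+1)}}{1-k(\gamma^2-1)}},\qquad M_{**}=\sqrt{\tfrac{k(\gamma+1)+1+(\gamma+1)\sqrt{k(k+1)}}{1-k(\gamma^2-1)}}\qquad(k(\gamma^2-1)<1),$$ $$I(M)=\sqrt{\big(\gamma+\tfrac1{M^2}\big)^2-2(\gamma+1)\big(\tfrac1{M^2}+\tfrac{\gamma-1}{2}\big)(1+k)},\quad \phi=\tfrac{1}{\gamma+1}\big(\gamma+\tfrac1{M^2}-I\big),\quad \psi=\tfrac{M^2}{\gamma+1}\big(\gamma+\tfrac1{M^2}+\gamma I\big).$$ For $M_1\ge M_*$ let $S$ be the number with $z:=M_1-S\ge1$ and $$M_*=\frac{((\gamma-1)M_1+2S)z+2}{\sqrt{2\gamma(\gamma-1)z^4+(6\gamma-\gamma^2-1)z^2-2(\gamma-1)}},$$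 let $f_2=\frac{2\gamma z^2-\gamma+1}{\gamma+1}$, $f_3=\frac{(\gamma-1)z^2+2}{(\gamma+1)z^2}$, $f_4=f_3+\frac{S}{M_1}(1-f_3)$, and $$Y(M_1)=M_1\big(f_4\,\phi(M_*)-1\big)-\sqrt{\tfrac{2}{\gamma(\gamma-1)}}\;\frac{f_2\,\psi(M_*)-1}{\sqrt{1+\frac{\gamma+1}{\gamma-1}f_2\,\psi(M_*)}} .$$ **Theorem.** (i) If $k(\gamma^2-1)\ge1$, then for every such $U_1$ the solution under the double CRPs frame with heating parameter $k$ is unique. (ii) If $k(\gamma^2-1)<1$ and no root of $Y$ in $[M_*,\infty)$ exceeds $M_{**}$, then for every such $U_1$ the solution under the double CRPs frame with heating parameter $k$ is unique. Here "unique" means: any two solutions coincide at each time $t\ge0$ except possibly at finitely many points $x$. -/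

import Mathlib

open Filter Topology Set

noncomputable section

namespace HeatedEuler

/-- A gas state in the primitive variables: density `ρ`, velocity `u`, pressure `p`. -/
structure GasState where
  ρ : ℝ
  u : ℝ
  p : ℝ

/-- Positive density and positive pressure. -/
def GasState.Physical (W : GasState) : Prop := 0 < W.ρ ∧ 0 < W.p

/-- Sound speed `a` of a polytropic ideal gas. -/
def soundSpeed (γ : ℝ) (W : GasState) : ℝ := √(γ * W.p / W.ρ)

/-- Mach number `u / a` (signed). -/
def mach (γ : ℝ) (W : GasState) : ℝ := W.u / soundSpeed γ W

/-- Total energy per volume, `E = ρ e + ρ u² / 2` with `p = (γ - 1) ρ e`. -/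
def totalEnergy (γ : ℝ) (W : GasState) : ℝ := W.p / (γ - 1) + W.ρ * W.u ^ 2 / 2

/-- Specific enthalpy `h = e + p / ρ`. -/
def enthalpy (γ : ℝ) (W : GasState) : ℝ := W.p / ((γ - 1) * W.ρ) + W.p / W.ρ

/-- The conserved variables `(ρ, ρ u, E)`. -/
def conserved (γ : ℝ) (W : GasState) : Fin 3 → ℝ :=
  ![W.ρ, W.ρ * W.u, totalEnergy γ W]

/-- The flux `(ρ u, ρ u² + p, (E + p) u)`. -/
def flux (γ : ℝ) (W : GasState) : Fin 3 → ℝ :=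
  ![W.ρ * W.u, W.ρ * W.u ^ 2 + W.p, (totalEnergy γ W + W.p) * W.u]

/-! ### Elementary waves and the classical Riemann problem

The two genuinely nonlinear fields are indexed by `σ = -1` (the field `u - a`) and
`σ = 1` (the field `u + a`). -/

/-- The characteristic speed `u + σ a`. -/
def charSpeed (γ σ : ℝ) (W : GasState) : ℝ := W.u + σ * soundSpeed γ W

/-- A shock of the field `u + σ a` with speed `s`: the Rankine-Hugoniot conditions and the
Lax entropy condition. -/
def IsShock (γ σ s : ℝ) (UL UR : GasState) : Prop :=
  flux γ UR - flux γ UL = s • (conserved γ UR - conserved γ UL) ∧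
  charSpeed γ σ UR < s ∧ s < charSpeed γ σ UL

/-- Two states with the same Riemann invariants of the field `u + σ a`:
the entropy function `p / ρ ^ γ` and `u - σ 2 a / (γ - 1)`. -/
def SameInvariants (γ σ : ℝ) (U W : GasState) : Prop :=
  W.p / W.ρ ^ γ = U.p / U.ρ ^ γ ∧
  W.u - σ * (2 * soundSpeed γ W / (γ - 1)) = U.u - σ * (2 * soundSpeed γ U / (γ - 1))

/-- In the self-similar profile `V` (a function of `ξ = x / t`), the states `UL` and `UR` are
joined by a wave of the field `u + σ a` that occupies `α ≤ ξ ≤ β`: no wave at all, a shock,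
or a centred rarefaction wave. -/
def IsNonlinearWave (γ σ : ℝ) (UL UR : GasState) (α β : ℝ) (V : ℝ → GasState) : Prop :=
  (α = β ∧ UL = UR) ∨
  (α = β ∧ IsShock γ σ α UL UR) ∨
  (α < β ∧ charSpeed γ σ UL = α ∧ charSpeed γ σ UR = β ∧ SameInvariants γ σ UL UR ∧
    ∀ ξ ∈ Ioo α β, (V ξ).Physical ∧ SameInvariants γ σ UL (V ξ) ∧ charSpeed γ σ (V ξ) = ξ)

/-- `V`, as a function of `ξ = x / t`, is a solution of the classical Riemann problem of the
homogeneous Euler equations with left data `UL` and right data `UR`: from left to right a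
`u - a` wave, a contact discontinuity (equal velocities and pressures) and a `u + a` wave,
with constant states in between; any of the three may be absent. The values of `V` on the
finitely many lines that bound the waves are left free. -/
def IsCRPSolution (γ : ℝ) (UL UR : GasState) (V : ℝ → GasState) : Prop :=
  ∃ (WL WR : GasState) (α₁ β₁ α₃ β₃ : ℝ),
    WL.Physical ∧ WR.Physical ∧
    IsNonlinearWave γ (-1) UL WL α₁ β₁ V ∧
    WL.u = WR.u ∧ WL.p = WR.p ∧
    IsNonlinearWave γ 1 WR UR α₃ β₃ V ∧
    β₁ ≤ WL.u ∧ WL.u ≤ α₃ ∧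
    (∀ ξ, ξ < α₁ → V ξ = UL) ∧
    (∀ ξ, β₁ < ξ → ξ < WL.u → V ξ = WL) ∧
    (∀ ξ, WL.u < ξ → ξ < α₃ → V ξ = WR) ∧
    (∀ ξ, β₃ < ξ → V ξ = UR)

/-! ### The heating point and the double CRPs frame -/

/-- The total enthalpy `u² / 2 + h`. -/
def totalEnthalpy (γ : ℝ) (W : GasState) : ℝ := W.u ^ 2 / 2 + enthalpy γ W

/-- The state `Uup` upstream and the state `Udown` downstream of the heating point are on the
physical branch: heating never carries the flow through Mach number one. -/
def PhysicalBranch (γ : ℝ) (Uup Udown : GasState) : Prop :=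
  (|mach γ Uup| < 1 → |mach γ Udown| ≤ 1) ∧ (1 < |mach γ Uup| → 1 ≤ |mach γ Udown|)

/-- The heating discontinuity at `x = 0` between the left limit `Um` and the right limit `Up`,
with heating parameter `k`: the energy flux jumps by the heat flux `Q > 0`, mass and momentum
fluxes do not jump, the velocities do not vanish, `k` is the ratio of `Q` to the total enthalpy
flux `ρ |u| (u² / 2 + h)` of the upstream state, and the physical branch is taken. The upstream
state is the left one if the gas flows to the right, and the right one otherwise. -/
def IsHeating (γ k : ℝ) (Um Up : GasState) : Prop :=
  Um.u ≠ 0 ∧ Up.u ≠ 0 ∧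
  ∃ Q : ℝ, 0 < Q ∧ flux γ Up = flux γ Um + ![0, 0, Q] ∧
    ((0 < Um.u ∧ k = Q / (Um.ρ * |Um.u| * totalEnthalpy γ Um) ∧ PhysicalBranch γ Um Up) ∨
     (Um.u < 0 ∧ k = Q / (Up.ρ * |Up.u| * totalEnthalpy γ Up) ∧ PhysicalBranch γ Up Um))

/-- Convergence of states, in each variable. -/
def TendstoState (f : ℝ → GasState) (l : Filter ℝ) (W : GasState) : Prop :=
  Tendsto (fun x => (f x).ρ) l (𝓝 W.ρ) ∧ Tendsto (fun x => (f x).u) l (𝓝 W.u) ∧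
  Tendsto (fun x => (f x).p) l (𝓝 W.p)

/-- `U x t` (for `t ≥ 0`) is a solution, in the double CRPs frame, of the Riemann problem with
constant initial state `U₁` and a heating point at `x = 0` with heating parameter `k`. There are
constant one-sided limits `Um = U(0-, t)` and `Up = U(0+, t)`; on `x < 0` the solution is the
left half of a solution of the classical Riemann problem with data `U₁`, `Um`; on `x > 0` it is
the right half of one with data `Up`, `U₁`; and `Um`, `Up` are coupled by the heating
discontinuity. -/
def IsDoubleCRPSolution (γ k : ℝ) (U₁ : GasState) (U : ℝ → ℝ → GasState) : Prop :=
  (∀ x, U x 0 = U₁) ∧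
  ∃ (Um Up : GasState) (VL VR : ℝ → GasState),
    Um.Physical ∧ Up.Physical ∧
    IsCRPSolution γ U₁ Um VL ∧ IsCRPSolution γ Up U₁ VR ∧
    (∀ t, 0 < t → ∀ x, x < 0 → U x t = VL (x / t)) ∧
    (∀ t, 0 < t → ∀ x, 0 < x → U x t = VR (x / t)) ∧
    (∀ t, 0 < t → TendstoState (fun x => U x t) (𝓝[<] 0) Um) ∧
    (∀ t, 0 < t → TendstoState (fun x => U x t) (𝓝[>] 0) Up) ∧
    IsHeating γ k Um Up

/-- There is at most one solution with the initial state `U₁`: at every time two solutions agree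
except possibly at finitely many points (the positions of the discontinuities). -/
def UniqueSolution (γ k : ℝ) (U₁ : GasState) : Prop :=
  ∀ U U' : ℝ → ℝ → GasState,
    IsDoubleCRPSolution γ k U₁ U → IsDoubleCRPSolution γ k U₁ U' →
    ∀ t, 0 ≤ t → {x : ℝ | U x t ≠ U' x t}.Finite

/-! ### The function `Y` -/

/-- The upstream Mach number `M_* < 1` at which heating makes the flow sonic. -/
def Mstar (γ k : ℝ) : ℝ :=
  if k * (γ ^ 2 - 1) = 1 then √(1 / (2 * (k * (γ + 1) + 1)))
  else √((k * (γ + 1) + 1 - (γ + 1) * √(k * (k + 1))) / (1 - k * (γ ^ 2 - 1)))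

/-- The upstream Mach number `M_** > 1` at which heating makes the flow sonic; it exists only
for `k (γ² - 1) < 1` and is used only there. -/
def Mstarstar (γ k : ℝ) : ℝ :=
  √((k * (γ + 1) + 1 + (γ + 1) * √(k * (k + 1))) / (1 - k * (γ ^ 2 - 1)))

def heatI (γ k M : ℝ) : ℝ :=
  √((γ + 1 / M ^ 2) ^ 2 - 2 * (γ + 1) * (1 / M ^ 2 + (γ - 1) / 2) * (1 + k))

/-- Velocity ratio across the heating point for subsonic upstream Mach number `M`. -/
def phi (γ k M : ℝ) : ℝ := 1 / (γ + 1) * (γ + 1 / M ^ 2 - heatI γ k M)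

/-- Pressure ratio across the heating point for subsonic upstream Mach number `M`. -/
def psi (γ k M : ℝ) : ℝ := M ^ 2 / (γ + 1) * (γ + 1 / M ^ 2 + γ * heatI γ k M)

/-- Pressure ratio across a `u - a` shock; `M₁` is the Mach number ahead of it and `S` its speed
divided by the sound speed ahead. -/
def f2 (γ M₁ S : ℝ) : ℝ := (2 * γ * (M₁ - S) ^ 2 - γ + 1) / (γ + 1)

def f3 (γ M₁ S : ℝ) : ℝ := ((γ - 1) * (M₁ - S) ^ 2 + 2) / ((γ + 1) * (M₁ - S) ^ 2)

/-- Velocity ratio across the shock. -/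
def f4 (γ M₁ S : ℝ) : ℝ := f3 γ M₁ S + S / M₁ * (1 - f3 γ M₁ S)

/-- Mach number behind the shock. -/
def f5 (γ M₁ S : ℝ) : ℝ :=
  (((γ - 1) * M₁ + 2 * S) * (M₁ - S) + 2) /
    √(2 * γ * (γ - 1) * (M₁ - S) ^ 4 + (6 * γ - γ ^ 2 - 1) * (M₁ - S) ^ 2 - 2 * (γ - 1))

/-- The shock Mach number `S` with `f5 M₁ S = M₄` and `M₁ - S ≥ 1`
(there is exactly one when `0 < M₄ ≤ M₁`). -/
def f6 (γ M₁ M₄ : ℝ) : ℝ :=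
  Classical.epsilon fun S : ℝ => M₄ = f5 γ M₁ S ∧ 1 ≤ M₁ - S

/-- The function `X(M₁, M₄)`, with `β = 2 / (γ - 1)` and `τ = (γ + 1) / (γ - 1)`. -/
def X (γ k M₁ M₄ : ℝ) : ℝ :=
  M₁ * (f4 γ M₁ (f6 γ M₁ M₄) * phi γ k M₄ - 1) -
    √((2 / (γ - 1)) / γ) * ((f2 γ M₁ (f6 γ M₁ M₄) * psi γ k M₄ - 1) /
      √(1 + (γ + 1) / (γ - 1) * (f2 γ M₁ (f6 γ M₁ M₄) * psi γ k M₄)))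

/-- The function `Y(M₁) = X(M₁, M_*)`, meaningful for `M₁ ≥ M_*`. -/
def Y (γ k M₁ : ℝ) : ℝ := X γ k M₁ (Mstar γ k)

end HeatedEuler

end

open HeatedEuler

namespace HeatedEuler

/-! The proof compares solutions by the monotonicity of wave curves. Along the curve of the field `u
- a` issuing from `U₁`, pressure and sound speed rise while velocity falls, so its states are
totally ordered by `WaveLT` (`OnWaveCurve.trichotomy`). By reflection, pressure and velocity rise
together on the `u + a` curve of states that connect to `U₁` on the right.

Let the gas flow to the right at `x = 0`. Then only a `u - a` wave fits into `x < 0`. If `U₋` is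
subsonic, heating preserves the order in pressure and velocity (`Heats.mono`): a higher `U₋` gives a
`U₊` of larger pressure and smaller velocity. Behind it a further `u - a` wave is possible only when
`U₊` is sonic (choked), and it is a rarefaction, which lowers pressure and raises velocity; the
higher of two competing states is never choked. Hence two different subsonic `U₋` would yield
contact states with opposite orders of pressure and velocity, against the `u + a` curve
(`not_waveLT`). If `U₋` is supersonic, no wave fits on the left and `U₋ = U₁`.

The two regimes exclude each other (`not_subsonic_and_supersonic`). A standing shock takes the
supersonic `U₁` to a subsonic state with the same fluxes, and heating sees only fluxes. A subsonic
solution contains a stronger, left-moving shock, so by `Heats.mono` it arrives at a state with more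
pressure and less velocity than `U₁`, which is off the `u + a` curve.

Flow to the left at `x = 0` is excluded by reflection and `initial_velocity_nonneg`. Once the states
are known, the wave profiles are determined up to their bounding lines. -/

/-- `W'` has larger pressure and sound speed and smaller velocity than `W`: the order of the
states on the wave curve of the field `u - a`. -/
def WaveLT (γ : ℝ) (W W' : GasState) : Prop :=
  W.p < W'.p ∧ W'.u < W.u ∧ soundSpeed γ W < soundSpeed γ W'

theorem soundSpeed_pos {γ : ℝ} (hγ : 1 < γ) {W : GasState} (hW : W.Physical) :
    0 < soundSpeed γ W :=
  Real.sqrt_pos.2 (div_pos (mul_pos (by linarith) hW.2) hW.1)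

theorem soundSpeed_sq {γ : ℝ} (hγ : 1 < γ) {W : GasState} (hW : W.Physical) :
    soundSpeed γ W ^ 2 = γ * W.p / W.ρ :=
  Real.sq_sqrt (div_nonneg (mul_nonneg (by linarith) hW.2.le) hW.1.le)

theorem density_mul_soundSpeed_sq {γ : ℝ} (hγ : 1 < γ) {W : GasState} (hW : W.Physical) :
    W.ρ * soundSpeed γ W ^ 2 = γ * W.p := by
  have := hW.1.ne'
  rw [soundSpeed_sq hγ hW]; field_simp

theorem GasState.eq_of {W W' : GasState} (h1 : W.ρ = W'.ρ) (h2 : W.u = W'.u) (h3 : W.p = W'.p) :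
    W = W' := by
  cases W; cases W'; simp_all

/-- Since `h = a² / (γ - 1)`, a constant mass flux reduces the energy balance to one between `a²`
and `u²`. -/
theorem energy_flux_eq {γ : ℝ} (hγ : 1 < γ) {W : GasState} (hW : W.Physical) :
    (totalEnergy γ W + W.p) * W.u =
      W.ρ * W.u * (soundSpeed γ W ^ 2 / (γ - 1) + W.u ^ 2 / 2) := by
  have h1 : γ - 1 ≠ 0 := by linarith
  have h2 := hW.1.ne'
  rw [soundSpeed_sq hγ hW, totalEnergy]; field_simp; ring

/-! ### Shocks of the field `u - a` -/

/-- In the frame of the shock, the jump relations in terms of the relative speed `U.u - s` ahead. -/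
theorem IsShock.relations {γ s : ℝ} (hγ : 1 < γ) {U W : GasState} (hU : U.Physical)
    (hW : W.Physical) (h : IsShock γ (-1) s U W) :
    soundSpeed γ U < U.u - s ∧ 0 < W.u - s ∧
    W.ρ * (W.u - s) = U.ρ * (U.u - s) ∧
    (γ + 1) * ((U.u - s) * (U.u - W.u)) = 2 * ((U.u - s) ^ 2 - soundSpeed γ U ^ 2) ∧
    (γ + 1) * (W.p - U.p) = 2 * U.ρ * ((U.u - s) ^ 2 - soundSpeed γ U ^ 2) ∧
    soundSpeed γ W ^ 2 = soundSpeed γ U ^ 2 + (γ - 1) / 2 * ((U.u - s) ^ 2 - (W.u - s) ^ 2) := by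
  obtain ⟨hf, h1, h2⟩ := h
  have e0 := congrFun hf 0
  have e1 := congrFun hf 1
  have e2 := congrFun hf 2
  simp only [flux, conserved, totalEnergy, Pi.sub_apply, Pi.smul_apply, smul_eq_mul,
    Matrix.cons_val, div_eq_mul_inv _ (γ - 1)] at e0 e1 e2
  have hG : γ * (γ - 1)⁻¹ = (γ - 1)⁻¹ + 1 := by
    have : γ - 1 ≠ 0 := by linarith
    field_simp; ring
  have pU := density_mul_soundSpeed_sq hγ hU
  have pW := density_mul_soundSpeed_sq hγ hW
  have aU := soundSpeed_pos hγ hU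
  have aW := soundSpeed_pos hγ hW
  simp only [charSpeed] at h1 h2
  set G := (γ - 1)⁻¹ with hGdef
  set a := soundSpeed γ U
  set b := soundSpeed γ W
  -- In the frame of the shock, with relative speeds `v` ahead and `w` behind, the jump relations
  -- become equality of mass, momentum and energy fluxes.
  obtain ⟨v, hv⟩ : ∃ v, v = U.u - s := ⟨_, rfl⟩
  obtain ⟨w, hw⟩ : ∃ w, w = W.u - s := ⟨_, rfl⟩
  have hvu : U.u = v + s := by rw [hv]; ring
  have hwu : W.u = w + s := by rw [hw]; ring
  rw [hvu, hwu] at e0 e1 e2 ⊢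
  simp only [add_sub_cancel_right, add_sub_add_right_eq_sub]
  have hav : a < v := by linarith
  have hwb : w < b := by linarith
  have m : W.ρ * w = U.ρ * v := by linear_combination e0
  have hρU := hU.1
  have hρW := hW.1
  have v0 : 0 < v := aU.trans hav
  have mv : 0 < U.ρ * v := mul_pos hρU v0
  have w0 : 0 < w := pos_of_mul_pos_right (m ▸ mv) hρW.le
  have mom : W.p - U.p = U.ρ * v * (v - w) := by
    linear_combination e1 - (w + s) * m
  have hg : 0 < γ - 1 := by linarith
  have eA : W.ρ * w * b ^ 2 * G = (G + 1) * W.p * w := by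
    linear_combination w * G * pW + W.p * w * hG
  have eB : U.ρ * v * a ^ 2 * G = (G + 1) * U.p * v := by
    linear_combination v * G * pU + U.p * v * hG
  have en' : U.ρ * v * ((b ^ 2 * G + w ^ 2 / 2) - (a ^ 2 * G + v ^ 2 / 2)) = 0 := by
    linear_combination eA - eB + e2 - (b ^ 2 * G + (w + s) ^ 2 / 2) * m - s * mom
  have en : b ^ 2 = a ^ 2 + (γ - 1) / 2 * (v ^ 2 - w ^ 2) := by
    have h0 := (mul_eq_zero.1 en').resolve_left mv.ne'
    have hG' : G * (γ - 1) = 1 := by rw [hGdef]; field_simp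
    linear_combination (γ - 1) * h0 + (a ^ 2 - b ^ 2) * hG'
  -- Equal relative speeds would give equal sound speeds, against `a < v` and `w < b`.
  have hvw : v - w ≠ 0 := by
    intro h0
    have hvw : v = w := by linarith
    have : b ^ 2 = a ^ 2 := by rw [en, hvw]; ring
    have : b = a := by
      rwa [sq_eq_sq₀ aW.le aU.le] at this
    linarith
  -- Eliminating the pressures and `b` leaves an equation with the trivial root `w = v`; the other
  -- factor is the shock relation.
  have pr' : (v - w) * (U.ρ * (2 * a ^ 2 + (γ - 1) * v ^ 2 - (γ + 1) * v * w)) = 0 := by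
    linear_combination 2 * γ * w * mom + 2 * w * pW - 2 * w * pU - 2 * b ^ 2 * m - 2 * U.ρ * v * en
  have pr : 2 * a ^ 2 + (γ - 1) * v ^ 2 - (γ + 1) * v * w = 0 :=
    (mul_eq_zero.1 ((mul_eq_zero.1 pr').resolve_left hvw)).resolve_left hρU.ne'
  refine ⟨hav, w0, m, ?_, ?_, en⟩
  · linear_combination pr
  · linear_combination (γ + 1) * mom + U.ρ * pr

/-- Of two shocks with the same state ahead, the slower one is the stronger one. -/
theorem IsShock.waveLT {γ s s' : ℝ} (hγ : 1 < γ) {U W W' : GasState} (hU : U.Physical)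
    (hW : W.Physical) (hW' : W'.Physical) (h : IsShock γ (-1) s U W)
    (h' : IsShock γ (-1) s' U W') (hs : s' < s) : WaveLT γ W W' := by
  obtain ⟨h1, h2, -, h4, h5, h6⟩ := h.relations hγ hU hW
  obtain ⟨h1', h2', -, h4', h5', h6'⟩ := h'.relations hγ hU hW'
  have aU := soundSpeed_pos hγ hU
  have aW' := soundSpeed_pos hγ hW'
  set a := soundSpeed γ U
  obtain ⟨v, hv⟩ : ∃ v, v = U.u - s := ⟨_, rfl⟩
  obtain ⟨v', hv'⟩ : ∃ v', v' = U.u - s' := ⟨_, rfl⟩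
  obtain ⟨d, hd⟩ : ∃ d, d = U.u - W.u := ⟨_, rfl⟩
  obtain ⟨d', hd'⟩ : ∃ d', d' = U.u - W'.u := ⟨_, rfl⟩
  have e : W.u - s = v - d := by rw [hv, hd]; ring
  have e' : W'.u - s' = v' - d' := by rw [hv', hd']; ring
  rw [← hv, ← hd] at h4
  rw [← hv', ← hd'] at h4'
  rw [← hv] at h1 h5
  rw [← hv'] at h1' h5'
  rw [← hv, e] at h6
  rw [← hv', e'] at h6'
  have hvv : v < v' := by linarith
  have v0 : 0 < v := by linarith
  have v0' : 0 < v' := by linarith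
  have hg : 0 < γ + 1 := by linarith
  have hsq : v ^ 2 < v' ^ 2 := pow_lt_pow_left₀ hvv v0.le two_ne_zero
  have hd0 : 0 < d := by
    have : 0 < (γ + 1) * (v * d) := by 
      rw [h4]; linarith [pow_lt_pow_left₀ h1 aU.le two_ne_zero]
    exact pos_of_mul_pos_right (pos_of_mul_pos_right this hg.le) v0.le
  -- The velocity drop `d` is proportional to `v - a² / v`, which increases with `v`. Denominators
  -- are cleared by `v * v'`.
  have hdd : d < d' := by
    by_contra hcon
    push Not at hcon
    have i1 : v * v' * d' ≤ v * v' * d := mul_le_mul_of_nonneg_left hcon (by positivity)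
    have i2 : (γ + 1) * (v * v' * d') - (γ + 1) * (v * v' * d) =
        2 * (v' - v) * (v * v' + a ^ 2) := by linear_combination v * h4' - v' * h4
    have i3 : 0 < 2 * (v' - v) * (v * v' + a ^ 2) :=
      mul_pos (by linarith) (by positivity)
    linarith [mul_le_mul_of_nonneg_left i1 hg.le]
  -- The sum `2 * v - d` of the relative speeds is proportional to `γ v + a² / v`, increasing for `v
  -- > a`. Multiplied by `d` it gives the drop of the squared relative speed, hence the rise of the
  -- squared sound speed.
  have hss : 2 * v - d < 2 * v' - d' := by
    by_contra hcon
    push Not at hcon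
    have i1 : v * v' * (2 * v' - d') ≤ v * v' * (2 * v - d) :=
      mul_le_mul_of_nonneg_left hcon (by positivity)
    have i2 : (γ + 1) * (v * v' * (2 * v' - d')) - (γ + 1) * (v * v' * (2 * v - d)) =
        2 * (v' - v) * (γ * (v * v') - a ^ 2) := by linear_combination v' * h4 - v * h4'
    have i4 : a ^ 2 < v * v' := by
      rw [sq]; exact mul_lt_mul'' h1 h1' aU.le aU.le
    have i5 : v * v' < γ * (v * v') := lt_mul_of_one_lt_left (mul_pos v0 v0') hγ
    have i3 : 0 < 2 * (v' - v) * (γ * (v * v') - a ^ 2) :=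
      mul_pos (by linarith) (by linarith)
    linarith [mul_le_mul_of_nonneg_left i1 hg.le]
  have hprod : d * (2 * v - d) < d' * (2 * v' - d') :=
    mul_lt_mul'' hdd hss hd0.le (by linarith)
  refine ⟨?_, by linarith, ?_⟩
  · have : (γ + 1) * (W.p - U.p) < (γ + 1) * (W'.p - U.p) := by
      rw [h5, h5']
      exact mul_lt_mul_of_pos_left (by linarith) (mul_pos two_pos hU.1)
    linarith [lt_of_mul_lt_mul_left this hg.le]
  · refine lt_of_pow_lt_pow_left₀ 2 aW'.le ?_
    rw [h6, h6']
    linear_combination (γ - 1) / 2 * hprod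

theorem IsShock.waveLT_ahead {γ s : ℝ} (hγ : 1 < γ) {U W : GasState} (hU : U.Physical)
    (hW : W.Physical) (h : IsShock γ (-1) s U W) : WaveLT γ U W := by
  obtain ⟨h1, h2, -, h4, h5, h6⟩ := h.relations hγ hU hW
  have aU := soundSpeed_pos hγ hU
  have aW := soundSpeed_pos hγ hW
  have hg : 0 < γ + 1 := by linarith
  have v0 : 0 < U.u - s := by linarith
  have hsq : 0 < (U.u - s) ^ 2 - soundSpeed γ U ^ 2 := by nlinarith
  have hd : 0 < U.u - W.u := by
    have : 0 < (γ + 1) * ((U.u - s) * (U.u - W.u)) := by rw [h4]; linarith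
    exact pos_of_mul_pos_right (pos_of_mul_pos_right this hg.le) v0.le
  refine ⟨?_, by linarith, ?_⟩
  · have : 0 < (γ + 1) * (W.p - U.p) := by
      rw [h5]; exact mul_pos (mul_pos two_pos hU.1) hsq
    linarith [pos_of_mul_pos_right this hg.le]
  · refine lt_of_pow_lt_pow_left₀ 2 aW.le ?_
    rw [h6]
    nlinarith [mul_pos (sub_pos.2 hγ) (mul_pos hd (by linarith : 0 < U.u - s + (W.u - s)))]

theorem IsShock.eq_of_speed_eq {γ s : ℝ} (hγ : 1 < γ) {U W W' : GasState} (hU : U.Physical)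
    (hW : W.Physical) (hW' : W'.Physical) (h : IsShock γ (-1) s U W)
    (h' : IsShock γ (-1) s U W') : W = W' := by
  obtain ⟨h1, h2, h3, h4, h5, -⟩ := h.relations hγ hU hW
  obtain ⟨h1', h2', h3', h4', h5', -⟩ := h'.relations hγ hU hW'
  have aU := soundSpeed_pos hγ hU
  have hg : γ + 1 ≠ 0 := by linarith
  have v0 : U.u - s ≠ 0 := by linarith
  have hu : W.u = W'.u := by
    have := mul_left_cancel₀ v0 (mul_left_cancel₀ hg (h4.trans h4'.symm))
    linarith
  have hp : W.p = W'.p := by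
    have := mul_left_cancel₀ hg (h5.trans h5'.symm)
    linarith
  refine GasState.eq_of ?_ hu hp
  rw [← hu] at h3'
  exact mul_right_cancel₀ h2.ne' (h3.trans h3'.symm)

/-! ### Rarefaction waves of the field `u - a` -/

/-- States with the same invariants of the field `u - a` are ordered by their density. -/
theorem SameInvariants.waveLT {γ : ℝ} (hγ : 1 < γ) {U W W' : GasState}
    (hW : W.Physical) (hW' : W'.Physical) (h : SameInvariants γ (-1) U W)
    (h' : SameInvariants γ (-1) U W') (hρ : W.ρ < W'.ρ) :
    WaveLT γ W W' ∧ charSpeed γ (-1) W' < charSpeed γ (-1) W := by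
  obtain ⟨h1, h2⟩ := h
  obtain ⟨h1', h2'⟩ := h'
  have hg : 0 < γ - 1 := by linarith
  have r := Real.rpow_pos_of_pos hW.1 γ
  have r' := Real.rpow_pos_of_pos hW'.1 γ
  obtain ⟨κ, hκ⟩ : ∃ κ, κ = U.p / U.ρ ^ γ := ⟨_, rfl⟩
  rw [← hκ, div_eq_iff r.ne'] at h1
  rw [← hκ, div_eq_iff r'.ne'] at h1'
  have hκ0 : 0 < κ := pos_of_mul_pos_left (h1 ▸ hW.2) r.le
  have hp : W.p < W'.p := by
    rw [h1, h1']
    exact mul_lt_mul_of_pos_left (Real.rpow_lt_rpow hW.1.le hρ (by linarith)) hκ0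
  have ha : soundSpeed γ W < soundSpeed γ W' := by
    refine Real.sqrt_lt_sqrt (div_nonneg (mul_nonneg (by linarith) hW.2.le) hW.1.le) ?_
    have key : ∀ x : ℝ, 0 < x → γ * (κ * x ^ γ) / x = γ * κ * x ^ (γ - 1) := by
      intro x hx
      rw [Real.rpow_sub_one hx.ne']; ring
    rw [h1, h1', key _ hW.1, key _ hW'.1]
    exact mul_lt_mul_of_pos_left (Real.rpow_lt_rpow hW.1.le hρ hg) (mul_pos (by linarith) hκ0)
  have hu : W'.u < W.u := by
    have : 2 * soundSpeed γ W / (γ - 1) < 2 * soundSpeed γ W' / (γ - 1) :=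
      (div_lt_div_iff_of_pos_right hg).2 (by linarith)
    linarith
  refine ⟨⟨hp, hu, ha⟩, ?_⟩
  simp only [charSpeed]; linarith

theorem SameInvariants.eq_of_density_eq {γ : ℝ} {U W W' : GasState}
    (hW : W.Physical) (h : SameInvariants γ (-1) U W)
    (h' : SameInvariants γ (-1) U W') (hρ : W.ρ = W'.ρ) : W = W' := by
  obtain ⟨h1, h2⟩ := h
  obtain ⟨h1', h2'⟩ := h'
  have r := Real.rpow_pos_of_pos hW.1 γ
  have hp : W.p = W'.p := by
    rw [← h1', hρ] at h1
    rw [hρ] at r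
    field_simp at h1; exact h1
  refine GasState.eq_of hρ ?_ hp
  have ha : soundSpeed γ W = soundSpeed γ W' := by rw [soundSpeed, soundSpeed, hp, hρ]
  rw [ha] at h2
  linarith

theorem SameInvariants.refl (γ σ : ℝ) (U : GasState) : SameInvariants γ σ U U := ⟨rfl, rfl⟩

theorem SameInvariants.eq_of_charSpeed_eq {γ : ℝ} (hγ : 1 < γ) {U W W' : GasState}
    (hW : W.Physical) (hW' : W'.Physical) (h : SameInvariants γ (-1) U W)
    (h' : SameInvariants γ (-1) U W') (hc : charSpeed γ (-1) W = charSpeed γ (-1) W') :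
    W = W' := by
  rcases lt_trichotomy W.ρ W'.ρ with hlt | heq | hlt
  · exact absurd hc (SameInvariants.waveLT hγ hW hW' h h' hlt).2.ne'
  · exact h.eq_of_density_eq hW h' heq
  · exact absurd hc (SameInvariants.waveLT hγ hW' hW h' h hlt).2.ne

theorem SameInvariants.waveLT_of_charSpeed_lt {γ : ℝ} (hγ : 1 < γ) {U W : GasState}
    (hU : U.Physical) (hW : W.Physical) (h : SameInvariants γ (-1) U W)
    (hc : charSpeed γ (-1) U < charSpeed γ (-1) W) : WaveLT γ W U := by
  rcases lt_trichotomy W.ρ U.ρ with hlt | heq | hlt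
  · exact (SameInvariants.waveLT hγ hW hU h (.refl γ _ U) hlt).1
  · exact absurd hc (by rw [h.eq_of_density_eq hW (.refl γ _ U) heq]; exact lt_irrefl _)
  · exact absurd hc (SameInvariants.waveLT hγ hU hW (.refl γ _ U) h hlt).2.not_gt

/-! ### The wave curve of the field `u - a` -/

/-- `W` can be joined to the state `U` ahead (on the left) by a wave of the field `u - a`. -/
def OnWaveCurve (γ : ℝ) (U W : GasState) : Prop :=
  W = U ∨ (∃ s, IsShock γ (-1) s U W) ∨
    (SameInvariants γ (-1) U W ∧ charSpeed γ (-1) U < charSpeed γ (-1) W)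

theorem WaveLT.trans {γ : ℝ} {U V W : GasState} (h : WaveLT γ U V) (h' : WaveLT γ V W) :
    WaveLT γ U W :=
  ⟨h.1.trans h'.1, h'.2.1.trans h.2.1, h.2.2.trans h'.2.2⟩

/-- Shock states lie above `U` and are ordered by shock speed; rarefaction states lie below `U` and
are ordered by density. -/
theorem OnWaveCurve.trichotomy {γ : ℝ} (hγ : 1 < γ) {U W W' : GasState} (hU : U.Physical)
    (hW : W.Physical) (hW' : W'.Physical) (h : OnWaveCurve γ U W) (h' : OnWaveCurve γ U W') :
    WaveLT γ W W' ∨ W = W' ∨ WaveLT γ W' W := by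
  rcases h with rfl | ⟨s, h⟩ | ⟨h, hc⟩ <;> rcases h' with rfl | ⟨s', h'⟩ | ⟨h', hc'⟩
  · exact Or.inr (Or.inl rfl)
  · exact Or.inl (h'.waveLT_ahead hγ hU hW')
  · exact Or.inr (Or.inr (h'.waveLT_of_charSpeed_lt hγ hU hW' hc'))
  · exact Or.inr (Or.inr (h.waveLT_ahead hγ hU hW))
  · rcases lt_trichotomy s s' with hs | rfl | hs
    · exact Or.inr (Or.inr (h'.waveLT hγ hU hW' hW h hs))
    · exact Or.inr (Or.inl (h.eq_of_speed_eq hγ hU hW hW' h'))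
    · exact Or.inl (h.waveLT hγ hU hW hW' h' hs)
  · exact Or.inr (Or.inr ((h'.waveLT_of_charSpeed_lt hγ hU hW' hc').trans
      (h.waveLT_ahead hγ hU hW)))
  · exact Or.inl (h.waveLT_of_charSpeed_lt hγ hU hW hc)
  · exact Or.inl ((h.waveLT_of_charSpeed_lt hγ hU hW hc).trans (h'.waveLT_ahead hγ hU hW'))
  · rcases lt_trichotomy W.ρ W'.ρ with hlt | heq | hlt
    · exact Or.inl (SameInvariants.waveLT hγ hW hW' h h' hlt).1
    · exact Or.inr (Or.inl (h.eq_of_density_eq hW h' heq))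
    · exact Or.inr (Or.inr (SameInvariants.waveLT hγ hW' hW h' h hlt).1)

theorem IsNonlinearWave.onWaveCurve {γ α β : ℝ} {U W : GasState} {V : ℝ → GasState}
    (h : IsNonlinearWave γ (-1) U W α β V) : OnWaveCurve γ U W := by
  rcases h with ⟨-, h⟩ | ⟨-, h⟩ | ⟨h, h1, h2, h3, -⟩
  · exact Or.inl h.symm
  · exact Or.inr (Or.inl ⟨α, h⟩)
  · exact Or.inr (Or.inr ⟨h3, by rw [h1, h2]; exact h⟩)

/-- The profile of a wave of the field `u - a` is determined by the two states it joins. -/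
theorem IsNonlinearWave.unique {γ α β α' β' : ℝ} (hγ : 1 < γ) {U W : GasState} (hU : U.Physical)
    (hW : W.Physical) {V V' : ℝ → GasState}
    (h : IsNonlinearWave γ (-1) U W α β V) (h' : IsNonlinearWave γ (-1) U W α' β' V') :
    (U = W ∧ α = β ∧ α' = β') ∨
      (α = α' ∧ β = β' ∧ ∀ ξ ∈ Ioo α β, V ξ = V' ξ) := by
  have irr : ∀ {W : GasState}, ¬ WaveLT γ W W := fun h => lt_irrefl _ h.1
  -- Waves of different kinds cannot join the same states, because a shock moves strictly up in
  -- `WaveLT` and a rarefaction strictly down.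
  rcases h with ⟨e, h⟩ | ⟨e, h⟩ | ⟨e, h1, h2, h3, h4⟩ <;>
    rcases h' with ⟨e', h'⟩ | ⟨e', h'⟩ | ⟨e', h1', h2', h3', h4'⟩
  · exact Or.inl ⟨h, e, e'⟩
  · subst h; exact absurd (h'.waveLT_ahead hγ hU hW) irr
  · subst h; rw [← h1', ← h2'] at e'; exact absurd e' (lt_irrefl _)
  · subst h'; exact absurd (h.waveLT_ahead hγ hU hW) irr
  · have : α = α' := by
      by_contra hne
      rcases lt_or_gt_of_ne hne with hlt | hlt
      · exact irr (h'.waveLT hγ hU hW hW h hlt)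
      · exact irr (h.waveLT hγ hU hW hW h' hlt)
    refine Or.inr ⟨this, by rw [← e, ← e', this], ?_⟩
    intro ξ hξ
    rw [← e] at hξ
    exact absurd (hξ.1.trans hξ.2) (lt_irrefl _)
  · rw [← h1', ← h2'] at e'
    exact absurd ((h.waveLT_ahead hγ hU hW).trans (h3'.waveLT_of_charSpeed_lt hγ hU hW e')) irr
  · subst h'; rw [← h1, ← h2] at e; exact absurd e (lt_irrefl _)
  · rw [← h1, ← h2] at e
    exact absurd ((h'.waveLT_ahead hγ hU hW).trans (h3.waveLT_of_charSpeed_lt hγ hU hW e)) irr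
  · refine Or.inr ⟨h1.symm.trans h1', h2.symm.trans h2', fun ξ hξ => ?_⟩
    obtain ⟨p1, p2, p3⟩ := h4 ξ hξ
    rw [← h1, ← h2, h1', h2'] at hξ
    obtain ⟨p1', p2', p3'⟩ := h4' ξ hξ
    exact p2.eq_of_charSpeed_eq hγ p1 p1' p2' (p3.trans p3'.symm)

/-! ### Heating of a flow to the right -/

/-- `V` is obtained from the upstream state `U` by heating with parameter `k`. -/
def Heats (γ k : ℝ) (U V : GasState) : Prop :=
  flux γ V = flux γ U + ![0, 0, k * flux γ U 2]

/-- The equation for the velocity ratio `x` across the heating point, where `τ` is the inverse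
square of the upstream Mach number. -/
def HeatEq (γ k τ x : ℝ) : Prop :=
  (γ + 1) * x ^ 2 - 2 * (γ + τ) * x + (1 + k) * (2 * τ + γ - 1) = 0

/-- At `τ = 1` the quadratic is `(γ + 1) * ((x - 1) ^ 2 + k)`, without real roots: a sonic flow
cannot be heated. -/
theorem HeatEq.ne_one {γ k τ x : ℝ} (hγ : 1 < γ) (hk : 0 < k) (h : HeatEq γ k τ x) : τ ≠ 1 := by
  rintro rfl
  have : (γ + 1) * ((x - 1) ^ 2 + k) = 0 := by rw [HeatEq] at h; linear_combination h
  have : 0 < (γ + 1) * ((x - 1) ^ 2 + k) := by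
    have : 0 < γ + 1 := by linarith
    positivity
  linarith

/-- The quadratic at `y`, factored by means of its root `x`. -/
theorem HeatEq.sub_eq {γ k τ x : ℝ} (h : HeatEq γ k τ x) (y : ℝ) :
    (γ + 1) * y ^ 2 - 2 * (γ + τ) * y + (1 + k) * (2 * τ + γ - 1) =
      (x - y) * ((γ + τ - (γ + 1) * x) + (γ + τ - (γ + 1) * y)) := by
  rw [HeatEq] at h; linear_combination h

/-- At `1 + k` the quadratic has the positive value `(1 + k) * (γ + 1) * k`, independent of `τ`. As
`1 + k` lies left of the vertex, by the sign of the discriminant, it lies below the smaller root. -/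
theorem HeatEq.lt_of_subsonic {γ k τ x : ℝ} (hγ : 1 < γ) (hk : 0 < k) (h : HeatEq γ k τ x)
    (hτ : 1 < τ) (hx : (γ + 1) * x ≤ γ + τ) : 1 + k < x := by
  by_contra hcon
  push Not at hcon
  have hpos : 0 < (γ + 1) * (1 + k) ^ 2 - 2 * (γ + τ) * (1 + k) + (1 + k) * (2 * τ + γ - 1) := by
    have : 0 < (1 + k) * ((γ + 1) * k) := by
      have : 0 < γ + 1 := by linarith
      positivity
    linarith
  have hv : (γ + 1) * (1 + k) < γ + τ := by
    have h1 : (γ + 1) * (1 + k) * (2 * τ + γ - 1) ≤ (γ + τ) ^ 2 := by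
      rw [HeatEq] at h
      nlinarith [sq_nonneg ((γ + 1) * x - (γ + τ))]
    have h2 : (γ + τ) ^ 2 < (γ + τ) * (2 * τ + γ - 1) := by nlinarith
    exact lt_of_mul_lt_mul_right (h1.trans_lt h2) (by linarith)
  rw [h.sub_eq] at hpos
  have := mul_nonneg (sub_nonneg.2 hcon) (by linarith :
    0 ≤ (γ + τ - (γ + 1) * x) + (γ + τ - (γ + 1) * (1 + k)))
  linarith

/-- For a subsonic upstream flow the velocity ratio increases with the Mach number, and a flow
that is slower than another possible one is not choked. -/
theorem HeatEq.lt_of_lt {γ k τ τ' x x' : ℝ} (hγ : 1 < γ) (hk : 0 < k) (h : HeatEq γ k τ x)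
    (h' : HeatEq γ k τ' x') (hτ : 1 < τ) (hτ' : τ < τ') (hx : (γ + 1) * x ≤ γ + τ)
    (hx' : (γ + 1) * x' ≤ γ + τ') : x' < x ∧ (γ + 1) * x' < γ + τ' := by
  have h1 := h.lt_of_subsonic hγ hk hτ hx
  -- The derivative of the quadratic in `τ` is `2 * (1 + k - x) < 0`, so `x` falls strictly between
  -- the roots for `τ'`.
  have hneg : (γ + 1) * x ^ 2 - 2 * (γ + τ') * x + (1 + k) * (2 * τ' + γ - 1) < 0 := by
    rw [HeatEq] at h
    have : 0 < (τ' - τ) * (x - (1 + k)) := mul_pos (by linarith) (by linarith)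
    linarith
  rw [h'.sub_eq] at hneg
  have hlt : x' < x := by
    by_contra hcon
    push Not at hcon
    have := mul_nonneg (sub_nonneg.2 hcon) (by linarith :
      0 ≤ (γ + τ' - (γ + 1) * x') + (γ + τ' - (γ + 1) * x))
    linarith
  have : 0 < (γ + 1) * (x - x') := mul_pos (by linarith) (by linarith)
  exact ⟨hlt, by linarith⟩

/-- For `τ < 1` the vertex lies below `1`, and the value at `1` is `k * (2 * τ + γ - 1) > 0`; so `1`
cannot lie between the vertex and the larger root. Supersonic heating thus slows the gas. -/
theorem HeatEq.lt_one {γ k τ x : ℝ} (hγ : 1 < γ) (hk : 0 < k) (h : HeatEq γ k τ x)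
    (hτ0 : 0 < τ) (hτ : τ < 1) (hx : γ + τ ≤ (γ + 1) * x) : x < 1 := by
  by_contra hcon
  push Not at hcon
  have e := h.sub_eq 1
  have h1 : 0 < k * (2 * τ + γ - 1) := mul_pos hk (by linarith)
  have := mul_nonneg (sub_nonneg.2 hcon) (by linarith :
      0 ≤ ((γ + 1) * x - (γ + τ)) + ((γ + 1) * 1 - (γ + τ)))
  linarith

/-- The vertex `(γ + τ) / (γ + 1)` separates the two roots; each branch keeps to one side of it. -/
theorem HeatEq.eq_of_subsonic {γ k τ x x' : ℝ} (hγ : 1 < γ) (h : HeatEq γ k τ x)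
    (h' : HeatEq γ k τ x') (hx : (γ + 1) * x ≤ γ + τ) (hx' : (γ + 1) * x' ≤ γ + τ) : x = x' := by
  have e := (h.sub_eq x').symm.trans h'
  rcases mul_eq_zero.1 e with e | e
  · linarith
  · have : (γ + 1) * (x - x') = 0 := by linarith
    rcases mul_eq_zero.1 this with e | e <;> linarith

theorem HeatEq.eq_of_supersonic {γ k τ x x' : ℝ} (hγ : 1 < γ) (h : HeatEq γ k τ x)
    (h' : HeatEq γ k τ x') (hx : γ + τ ≤ (γ + 1) * x) (hx' : γ + τ ≤ (γ + 1) * x') : x = x' := by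
  have e := (h.sub_eq x').symm.trans h'
  rcases mul_eq_zero.1 e with e | e
  · linarith
  · have : (γ + 1) * (x - x') = 0 := by linarith
    rcases mul_eq_zero.1 this with e | e <;> linarith

/-! ### Heating of gas states, through the quadratic for the velocity ratio -/

/-- The inverse square of the Mach number. -/
noncomputable def invMachSq (γ : ℝ) (U : GasState) : ℝ := soundSpeed γ U ^ 2 / U.u ^ 2

theorem one_lt_invMachSq {γ : ℝ} {U : GasState} (hu : 0 < U.u) :
    U.u < soundSpeed γ U → 1 < invMachSq γ U := fun h => by
  rw [invMachSq, one_lt_div (by positivity)]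
  exact pow_lt_pow_left₀ h hu.le two_ne_zero

theorem invMachSq_pos {γ : ℝ} (hγ : 1 < γ) {U : GasState} (hU : U.Physical) (hu : 0 < U.u) :
    0 < invMachSq γ U :=
  div_pos (pow_pos (soundSpeed_pos hγ hU) 2) (pow_pos hu 2)

theorem invMachSq_lt_one {γ : ℝ} (hγ : 1 < γ) {U : GasState} (hU : U.Physical) (hu : 0 < U.u) :
    soundSpeed γ U < U.u → invMachSq γ U < 1 := fun h => by
  rw [invMachSq, div_lt_one (by positivity)]
  exact pow_lt_pow_left₀ h (soundSpeed_pos hγ hU).le two_ne_zero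

/-- The heated state in terms of the velocity ratio `x`. -/
theorem Heats.exists_ratio {γ k : ℝ} (hγ : 1 < γ) {U V : GasState} (hU : U.Physical)
    (hV : V.Physical) (hu : 0 < U.u) (h : Heats γ k U V) :
    ∃ x, 0 < x ∧ HeatEq γ k (invMachSq γ U) x ∧ V.u = U.u * x ∧ V.ρ * x = U.ρ ∧
      V.p = U.p * (1 - γ * ((x - 1) / invMachSq γ U)) ∧
      (V.u ≤ soundSpeed γ V ↔ (γ + 1) * x ≤ γ + invMachSq γ U) ∧
      (V.u < soundSpeed γ V ↔ (γ + 1) * x < γ + invMachSq γ U) := by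
  have e0 := congrFun h 0
  have e1 := congrFun h 1
  have e2 := congrFun h 2
  simp only [flux, Pi.add_apply, Matrix.cons_val, add_zero] at e0 e1 e2
  rw [energy_flux_eq hγ hU, energy_flux_eq hγ hV] at e2
  have pU := density_mul_soundSpeed_sq hγ hU
  have pV := density_mul_soundSpeed_sq hγ hV
  have aU := soundSpeed_pos hγ hU
  have aV := soundSpeed_pos hγ hV
  have hρU := hU.1
  have hρV := hV.1
  have hτ0 := invMachSq_pos hγ hU hu
  obtain ⟨x, hx⟩ : ∃ x, x = V.u / U.u := ⟨_, rfl⟩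
  have hVu : V.u = U.u * x := by rw [hx]; field_simp
  have hm : V.ρ * x = U.ρ := by
    rw [hVu] at e0
    exact mul_right_cancel₀ hu.ne' (by linarith)
  have x0 : 0 < x := pos_of_mul_pos_right (hm ▸ hρU) hρV.le
  have hA : soundSpeed γ U ^ 2 = invMachSq γ U * U.u ^ 2 := by rw [invMachSq]; field_simp
  obtain ⟨τ, hτ⟩ : ∃ τ, τ = invMachSq γ U := ⟨_, rfl⟩
  rw [← hτ] at hA hτ0 ⊢
  rw [hA] at pU e2
  have hp : V.p = U.p - U.ρ * U.u ^ 2 * (x - 1) := by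
    rw [hVu] at e1
    linear_combination e1 - U.u ^ 2 * x * hm
  have hB : soundSpeed γ V ^ 2 = U.u ^ 2 * (x * (τ - γ * (x - 1))) := by
    apply mul_left_cancel₀ hρV.ne'
    rw [pV, hp]
    linear_combination -pU - U.u ^ 2 * (τ - γ * (x - 1)) * hm
  -- Sonic flow downstream corresponds exactly to the vertex of the quadratic.
  have hdiff : soundSpeed γ V ^ 2 - V.u ^ 2 = U.u ^ 2 * x * (γ + τ - (γ + 1) * x) := by
    rw [hB, hVu]; ring
  have hux : 0 < U.u ^ 2 * x := by positivity
  have vu : 0 < V.u := by rw [hVu]; positivity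
  refine ⟨x, x0, ?_, hVu, hm, ?_, ?_, ?_⟩
  · have hg : γ - 1 ≠ 0 := by linarith
    have e3 : V.ρ * V.u * (soundSpeed γ V ^ 2 / (γ - 1) + V.u ^ 2 / 2) =
        V.ρ * V.u * ((1 + k) * (τ * U.u ^ 2 / (γ - 1) + U.u ^ 2 / 2)) := by
      rw [e0] at e2 ⊢; linear_combination e2
    have e4 := mul_left_cancel₀ (mul_pos hρV vu).ne' e3
    rw [hB, hVu] at e4
    field_simp at e4
    rw [HeatEq]
    linear_combination -e4
  · rw [hp]
    have : U.ρ * U.u ^ 2 = γ * U.p / τ := by field_simp; linarith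
    rw [this]; ring
  · rw [← pow_le_pow_iff_left₀ vu.le aV.le two_ne_zero, ← sub_nonneg, hdiff,
      mul_nonneg_iff_of_pos_left hux, sub_nonneg]
  · rw [← pow_lt_pow_iff_left₀ vu.le aV.le two_ne_zero, ← sub_pos, hdiff,
      mul_pos_iff_of_pos_left hux, sub_pos]

theorem Heats.velocity_pos {γ k : ℝ} {U V : GasState} (hU : U.Physical)
    (hV : V.Physical) (hu : 0 < U.u) (h : Heats γ k U V) : 0 < V.u := by
  have e0 := congrFun h 0
  simp only [flux, Pi.add_apply, Matrix.cons_val, add_zero] at e0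
  exact pos_of_mul_pos_right (e0 ▸ mul_pos hU.1 hu) hV.1.le

theorem Heats.not_sonic {γ k : ℝ} (hγ : 1 < γ) (hk : 0 < k) {U V : GasState} (hU : U.Physical)
    (hV : V.Physical) (hu : 0 < U.u) (h : Heats γ k U V) : U.u ≠ soundSpeed γ U := by
  intro e
  obtain ⟨x, -, hx, -⟩ := h.exists_ratio hγ hU hV hu
  refine hx.ne_one hγ hk ?_
  rw [invMachSq, ← e, div_self (by positivity)]

/-- Monotonicity of heating: a slower, hotter subsonic state of higher pressure becomes a slower
state of higher pressure, and is not choked. -/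
theorem Heats.mono {γ k : ℝ} (hγ : 1 < γ) (hk : 0 < k) {U V U' V' : GasState} (hU : U.Physical)
    (hV : V.Physical) (hU' : U'.Physical) (hV' : V'.Physical) (hu' : 0 < U'.u)
    (h : Heats γ k U V) (h' : Heats γ k U' V') (hlt : WaveLT γ U U')
    (hs : U.u < soundSpeed γ U) (hVs : V.u ≤ soundSpeed γ V) (hVs' : V'.u ≤ soundSpeed γ V') :
    V.p < V'.p ∧ V'.u < V.u ∧ V'.u < soundSpeed γ V' := by
  obtain ⟨hp, huu, ha⟩ := hlt
  have hu : 0 < U.u := hu'.trans huu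
  obtain ⟨x, x0, hx, e1, -, e3, e4, -⟩ := h.exists_ratio hγ hU hV hu
  obtain ⟨x', x0', hx', e1', -, e3', e4', e5'⟩ := h'.exists_ratio hγ hU' hV' hu'
  have hτ := one_lt_invMachSq hu hs
  have hττ : invMachSq γ U < invMachSq γ U' := by
    rw [invMachSq, invMachSq]
    have := soundSpeed_pos hγ hU
    have := soundSpeed_pos hγ hU'
    apply div_lt_div₀ (pow_lt_pow_left₀ ha (by linarith) two_ne_zero)
      (pow_le_pow_left₀ hu'.le huu.le 2) (by positivity) (by positivity)
  have k1 := hx'.lt_of_subsonic hγ hk (hτ.trans hττ) (e4'.1 hVs')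
  obtain ⟨k2, k3⟩ := hx.lt_of_lt hγ hk hx' hτ hττ (e4.1 hVs) (e4'.1 hVs')
  refine ⟨?_, ?_, e5'.2 k3⟩
  -- The pressure ratio is `1 - γ (x - 1) / τ`; a smaller `x` and a larger `τ` both increase it.
  · have hq : (x' - 1) / invMachSq γ U' < (x - 1) / invMachSq γ U :=
      div_lt_div₀ (by linarith) hττ.le (by linarith) (by linarith)
    have h1 : 0 < 1 - γ * ((x - 1) / invMachSq γ U) :=
      pos_of_mul_pos_right (e3 ▸ hV.2) hU.2.le
    rw [e3, e3']
    refine mul_lt_mul'' hp ?_ hU.2.le h1.le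
    have := mul_lt_mul_of_pos_left hq (by linarith : 0 < γ)
    linarith
  · rw [e1, e1']
    exact mul_lt_mul'' huu k2 hu'.le x0'.le

theorem Heats.pressure_lt {γ k : ℝ} (hγ : 1 < γ) (hk : 0 < k) {U V : GasState} (hU : U.Physical)
    (hV : V.Physical) (hu : 0 < U.u) (h : Heats γ k U V)
    (hs : U.u < soundSpeed γ U) (hVs : V.u ≤ soundSpeed γ V) : V.p < U.p := by
  obtain ⟨x, x0, hx, -, -, e3, e4, -⟩ := h.exists_ratio hγ hU hV hu
  have hτ := one_lt_invMachSq hu hs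
  have k1 := hx.lt_of_subsonic hγ hk hτ (e4.1 hVs)
  have : 0 < (x - 1) / invMachSq γ U := div_pos (by linarith) (by linarith)
  rw [e3]
  have := mul_pos hU.2 (mul_pos (by linarith : 0 < γ) this)
  linarith

theorem Heats.velocity_lt {γ k : ℝ} (hγ : 1 < γ) (hk : 0 < k) {U V : GasState} (hU : U.Physical)
    (hV : V.Physical) (hu : 0 < U.u) (h : Heats γ k U V)
    (hs : soundSpeed γ U < U.u) (hVs : soundSpeed γ V ≤ V.u) : V.u < U.u := by
  obtain ⟨x, x0, hx, e1, -, -, -, e5⟩ := h.exists_ratio hγ hU hV hu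
  have k1 := hx.lt_one hγ hk (invMachSq_pos hγ hU hu) (invMachSq_lt_one hγ hU hu hs)
    (not_lt.1 (fun h => hVs.not_gt (e5.2 h)))
  rw [e1]; exact mul_lt_of_lt_one_right hu k1

/-- Heating is deterministic on each of the two branches. -/
theorem Heats.unique {γ k : ℝ} (hγ : 1 < γ) {U V V' : GasState} (hU : U.Physical)
    (hV : V.Physical) (hV' : V'.Physical) (hu : 0 < U.u)
    (h : Heats γ k U V) (h' : Heats γ k U V')
    (hs : (V.u ≤ soundSpeed γ V ∧ V'.u ≤ soundSpeed γ V') ∨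
      (soundSpeed γ V ≤ V.u ∧ soundSpeed γ V' ≤ V'.u)) : V = V' := by
  obtain ⟨x, x0, hx, e1, e2, e3, e4, e5⟩ := h.exists_ratio hγ hU hV hu
  obtain ⟨x', x0', hx', e1', e2', e3', e4', e5'⟩ := h'.exists_ratio hγ hU hV' hu
  have : x = x' := by
    rcases hs with ⟨s, s'⟩ | ⟨s, s'⟩
    · exact hx.eq_of_subsonic hγ hx' (e4.1 s) (e4'.1 s')
    · exact hx.eq_of_supersonic hγ hx' (not_lt.1 (fun h => s.not_gt (e5.2 h)))
        (not_lt.1 (fun h => s'.not_gt (e5'.2 h)))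
  subst this
  exact GasState.eq_of (mul_right_cancel₀ x0.ne' (e2.trans e2'.symm)) (e1.trans e1'.symm)
    (e3.trans e3'.symm)

/-! ### Conjugate states across a standing shock -/

/-- The subsonic state with the same fluxes as a given supersonic state. -/
theorem exists_conjugate {γ : ℝ} (hγ : 1 < γ) {W : GasState} (hW : W.Physical)
    (hs : soundSpeed γ W ≤ W.u) :
    ∃ W' : GasState, W'.Physical ∧ flux γ W' = flux γ W ∧ 0 < W'.u ∧
      W'.u ≤ W.u ∧ W'.u ≤ soundSpeed γ W' ∧
      (soundSpeed γ W < W.u → W'.u < soundSpeed γ W') := by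
  have a0 := soundSpeed_pos hγ hW
  have pW := density_mul_soundSpeed_sq hγ hW
  obtain ⟨ρ, u, p⟩ := W
  obtain ⟨hρ, hp⟩ := hW
  dsimp only at *
  set a := soundSpeed γ ⟨ρ, u, p⟩
  have hu : 0 < u := a0.trans_le hs
  have hsq : γ * p ≤ ρ * u ^ 2 := by
    rw [← pW]; exact mul_le_mul_of_nonneg_left (pow_le_pow_left₀ a0.le hs 2) hρ.le
  -- With mass and momentum fluxes fixed, energy conservation is quadratic in the velocity, with one
  -- root `u`; this is the other. The density `ρ u / v` and the pressure `q` keep the first two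
  -- fluxes. At a sonic state `v = u`.
  obtain ⟨v, hv⟩ : ∃ v, v = (2 * γ * p + (γ - 1) * (ρ * u ^ 2)) / ((γ + 1) * (ρ * u)) := ⟨_, rfl⟩
  have hg : 0 < γ + 1 := by linarith
  have hg1 : 0 < γ - 1 := by linarith
  have hg0 : 0 < γ := by linarith
  have v0 : 0 < v := by rw [hv]; positivity
  have hv' : (γ + 1) * (ρ * u) * v = 2 * γ * p + (γ - 1) * (ρ * u ^ 2) := by
    rw [hv]; field_simp
  obtain ⟨q, hq⟩ : ∃ q, q = p + ρ * u * (u - v) := ⟨_, rfl⟩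
  have hq' : (γ + 1) * q = 2 * (ρ * u ^ 2) - (γ - 1) * p := by
    rw [hq]; linear_combination -hv'
  have q0 : 0 < q := by
    have : 0 < (γ + 1) * q := by rw [hq']; nlinarith
    exact pos_of_mul_pos_right this hg.le
  have hvu : v ≤ u := by
    have : (γ + 1) * (ρ * u) * v ≤ (γ + 1) * (ρ * u) * u := by rw [hv']; linarith
    exact le_of_mul_le_mul_left this (by positivity)
  have hW' : GasState.Physical ⟨ρ * u / v, v, q⟩ := ⟨by positivity, q0⟩
  have a0' := soundSpeed_pos hγ hW'
  have pW' := density_mul_soundSpeed_sq hγ hW'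
  dsimp only at pW'
  set b := soundSpeed γ ⟨ρ * u / v, v, q⟩
  -- This says `ρ' (b² - v²) = ρ (u² - a²)`: the conjugate is subsonic as soon as the given state is
  -- supersonic.
  have hb : (γ + 1) * (ρ * u / v * (b ^ 2 - v ^ 2)) = (γ + 1) * (ρ * u ^ 2 - γ * p) := by
    have : ρ * u / v * v ^ 2 = ρ * u * v := by field_simp
    linear_combination (γ + 1) * pW' + γ * hq' - (γ + 1) * this - hv'
  have hb' := mul_left_cancel₀ hg.ne' hb
  have r0 : 0 < ρ * u / v := by positivity
  refine ⟨⟨ρ * u / v, v, q⟩, hW', ?_, v0, hvu, ?_, ?_⟩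
  · have h1 : ρ * u / v * v = ρ * u := by field_simp
    funext i
    fin_cases i
    · simpa [flux] using h1
    · have : ρ * u / v * v ^ 2 + q = ρ * u ^ 2 + p := by
        rw [hq]; linear_combination v * h1
      simpa [flux] using this
    · have : (q / (γ - 1) + ρ * u / v * v ^ 2 / 2 + q) * v =
          (p / (γ - 1) + ρ * u ^ 2 / 2 + p) * u := by
        have h3 : ρ * u / v * v ^ 2 = ρ * u * v := by linear_combination v * h1
        rw [h3]
        field_simp
        rw [hq]
        linear_combination (u - v) * hv'
      simpa [flux, totalEnergy] using this
  · rw [← pow_le_pow_iff_left₀ v0.le a0'.le two_ne_zero, ← sub_nonneg,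
      ← mul_nonneg_iff_of_pos_left r0, hb']
    linarith
  · intro hlt
    rw [← pow_lt_pow_iff_left₀ v0.le a0'.le two_ne_zero, ← sub_pos,
      ← mul_pos_iff_of_pos_left r0, hb', ← pW, ← mul_sub]
    exact mul_pos hρ (sub_pos.2 (pow_lt_pow_left₀ hlt a0.le two_ne_zero))

/-! ### Reflection -/

/-- The state seen after the reflection `x ↦ -x`. -/
def GasState.reflect (W : GasState) : GasState := ⟨W.ρ, -W.u, W.p⟩

theorem GasState.reflect_reflect (W : GasState) : W.reflect.reflect = W := by
  simp [reflect]

theorem GasState.reflect_injective {W W' : GasState} (h : W.reflect = W'.reflect) : W = W' := by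
  rw [← W.reflect_reflect, h, W'.reflect_reflect]

theorem GasState.Physical.reflect {W : GasState} (h : W.Physical) : W.reflect.Physical := h

theorem soundSpeed_reflect (γ : ℝ) (W : GasState) :
    soundSpeed γ W.reflect = soundSpeed γ W := rfl

theorem charSpeed_reflect (γ σ : ℝ) (W : GasState) :
    charSpeed γ (-σ) W.reflect = -charSpeed γ σ W := by
  simp only [charSpeed, soundSpeed_reflect]; simp only [GasState.reflect]; ring

theorem mach_reflect (γ : ℝ) (W : GasState) : mach γ W.reflect = -mach γ W := by
  simp only [mach, soundSpeed_reflect]; simp only [GasState.reflect]; ring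

theorem flux_reflect (γ : ℝ) (W : GasState) :
    flux γ W.reflect = ![-flux γ W 0, flux γ W 1, -flux γ W 2] := by
  funext i; fin_cases i <;> simp [flux, GasState.reflect, totalEnergy]

theorem conserved_reflect (γ : ℝ) (W : GasState) :
    conserved γ W.reflect = ![conserved γ W 0, -conserved γ W 1, conserved γ W 2] := by
  funext i; fin_cases i <;> simp [conserved, GasState.reflect, totalEnergy]

/-- Reflection flips the mass and energy fluxes and the momentum, and keeps the other components. It
exchanges the two fields, so results for `u - a` carry over to `u + a`. -/
theorem IsShock.reflect {γ σ s : ℝ} {UL UR : GasState} (h : IsShock γ σ s UL UR) :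
    IsShock γ (-σ) (-s) UR.reflect UL.reflect := by
  obtain ⟨h, h1, h2⟩ := h
  refine ⟨?_, by rw [charSpeed_reflect]; linarith, by rw [charSpeed_reflect]; linarith⟩
  have e0 := congrFun h 0
  have e1 := congrFun h 1
  have e2 := congrFun h 2
  simp only [Pi.sub_apply, Pi.smul_apply, smul_eq_mul] at e0 e1 e2
  rw [flux_reflect, flux_reflect, conserved_reflect, conserved_reflect]
  funext i
  fin_cases i
  · simp; linarith
  · simp; linarith
  · simp; linarith

theorem SameInvariants.reflect {γ σ : ℝ} {U W : GasState} (h : SameInvariants γ σ U W) :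
    SameInvariants γ (-σ) U.reflect W.reflect := by
  obtain ⟨h1, h2⟩ := h
  refine ⟨h1, ?_⟩
  simp only [soundSpeed_reflect]; simp only [GasState.reflect]; linarith

theorem SameInvariants.symm {γ σ : ℝ} {U W : GasState} (h : SameInvariants γ σ U W) :
    SameInvariants γ σ W U := ⟨h.1.symm, h.2.symm⟩

theorem SameInvariants.trans {γ σ : ℝ} {U V W : GasState} (h : SameInvariants γ σ U V)
    (h' : SameInvariants γ σ V W) : SameInvariants γ σ U W :=
  ⟨h'.1.trans h.1, h'.2.trans h.2⟩

/-- The reflected self-similar profile. -/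
def reflectProfile (V : ℝ → GasState) (ξ : ℝ) : GasState := (V (-ξ)).reflect

theorem IsNonlinearWave.reflect {γ σ α β : ℝ} {UL UR : GasState} {V : ℝ → GasState}
    (h : IsNonlinearWave γ σ UL UR α β V) :
    IsNonlinearWave γ (-σ) UR.reflect UL.reflect (-β) (-α) (reflectProfile V) := by
  rcases h with ⟨h, e⟩ | ⟨h, e⟩ | ⟨h, h1, h2, h3, h4⟩
  · exact Or.inl ⟨by rw [h], by rw [e]⟩
  · exact Or.inr (Or.inl ⟨by rw [h], by rw [← h]; exact e.reflect⟩)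
  · refine Or.inr (Or.inr ⟨by linarith, by rw [charSpeed_reflect, h2],
      by rw [charSpeed_reflect, h1], h3.symm.reflect, fun ξ hξ => ?_⟩)
    obtain ⟨p1, p2, p3⟩ := h4 (-ξ) ⟨by linarith [hξ.2], by linarith [hξ.1]⟩
    refine ⟨p1.reflect, (h3.symm.trans p2).reflect, ?_⟩
    rw [reflectProfile, charSpeed_reflect, p3, neg_neg]

theorem IsCRPSolution.reflect {γ : ℝ} {UL UR : GasState} {V : ℝ → GasState}
    (h : IsCRPSolution γ UL UR V) :
    IsCRPSolution γ UR.reflect UL.reflect (reflectProfile V) := by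
  obtain ⟨WL, WR, α₁, β₁, α₃, β₃, pL, pR, w1, hu, hp, w3, o1, o3, v1, v2, v3, v4⟩ := h
  refine ⟨WR.reflect, WL.reflect, -β₃, -α₃, -β₁, -α₁, pR.reflect, pL.reflect, w3.reflect,
    by simp [GasState.reflect, hu], hp.symm, ?_, ?_, ?_, ?_, ?_, ?_, ?_⟩
  · simpa using w1.reflect
  · simp only [GasState.reflect]; linarith
  · simp only [GasState.reflect]; linarith
  · intro ξ hξ
    rw [reflectProfile, v4 _ (by linarith)]
  · intro ξ h1 h2
    simp only [GasState.reflect] at h2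
    rw [reflectProfile, v3 _ (by linarith) (by linarith)]
  · intro ξ h1 h2
    simp only [GasState.reflect] at h1
    rw [reflectProfile, v2 _ (by linarith) (by linarith)]
  · intro ξ hξ
    rw [reflectProfile, v1 _ (by linarith)]

theorem TendstoState.reflect_left {V : ℝ → GasState} {W : GasState}
    (h : TendstoState V (𝓝[<] 0) W) : TendstoState (reflectProfile V) (𝓝[>] 0) W.reflect := by
  have hn : Tendsto (fun x : ℝ => -x) (𝓝[>] 0) (𝓝[<] 0) := by
    simpa using tendsto_neg_nhdsGT (a := (0 : ℝ))
  exact ⟨h.1.comp hn, (h.2.1.comp hn).neg, h.2.2.comp hn⟩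

theorem TendstoState.reflect_right {V : ℝ → GasState} {W : GasState}
    (h : TendstoState V (𝓝[>] 0) W) : TendstoState (reflectProfile V) (𝓝[<] 0) W.reflect := by
  have hn : Tendsto (fun x : ℝ => -x) (𝓝[<] 0) (𝓝[>] 0) := by
    simpa using tendsto_neg_nhdsLT (a := (0 : ℝ))
  exact ⟨h.1.comp hn, (h.2.1.comp hn).neg, h.2.2.comp hn⟩

/-! ### The two halves of the solution -/

theorem TendstoState.congr' {f g : ℝ → GasState} {l : Filter ℝ} {W : GasState}
    (h : TendstoState f l W) (hfg : f =ᶠ[l] g) : TendstoState g l W :=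
  ⟨h.1.congr' (hfg.fun_comp GasState.ρ), h.2.1.congr' (hfg.fun_comp GasState.u),
    h.2.2.congr' (hfg.fun_comp GasState.p)⟩

theorem TendstoState.eq_of_eventually {f : ℝ → GasState} {l : Filter ℝ} [l.NeBot] {W W' : GasState}
    (h : TendstoState f l W) (hf : ∀ᶠ x in l, f x = W') : W = W' := by
  have h' := h.congr' (g := fun _ => W') hf
  exact GasState.eq_of (tendsto_nhds_unique h'.1 tendsto_const_nhds)
    (tendsto_nhds_unique h'.2.1 tendsto_const_nhds) (tendsto_nhds_unique h'.2.2 tendsto_const_nhds)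

/-- A fan that reaches the line `ξ = 0` is sonic there. -/
theorem TendstoState.charSpeed_eq_zero {γ σ : ℝ} {f : ℝ → GasState} {l : Filter ℝ} [l.NeBot]
    (hl : l ≤ 𝓝 0) {W : GasState} (hW : W.Physical) (h : TendstoState f l W)
    (hf : ∀ᶠ x in l, charSpeed γ σ (f x) = x) : charSpeed γ σ W = 0 := by
  have h1 : Tendsto (fun x => charSpeed γ σ (f x)) l (𝓝 (charSpeed γ σ W)) :=
    h.2.1.add (((h.2.2.const_mul γ).div h.1 hW.1.ne').sqrt.const_mul σ)
  have h2 : Tendsto (fun x => charSpeed γ σ (f x)) l (𝓝 0) :=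
    (tendsto_id'.2 hl).congr' (hf.mono fun x hx => hx.symm)
  exact tendsto_nhds_unique h1 h2

/-- On `ξ < 0` the profile consists of a `u - a` wave of negative speed from `U₁` to `Um`. -/
def LeftHalf (γ : ℝ) (U₁ Um : GasState) (V : ℝ → GasState) : Prop :=
  ∃ α β, IsNonlinearWave γ (-1) U₁ Um α β V ∧ β < 0 ∧ (∀ ξ, ξ < α → V ξ = U₁) ∧
    ∀ ξ, β < ξ → ξ < 0 → V ξ = Um

/-- On `ξ > 0` the profile consists of a `u - a` wave from `Up` to `WL` of nonnegative speed, a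
contact discontinuity of positive speed from `WL` to `WR` and a `u + a` wave from `WR` to `U₁`. -/
def RightHalf (γ : ℝ) (Up U₁ WL WR : GasState) (V : ℝ → GasState) : Prop :=
  ∃ α₁ β₁ α₃ β₃, IsNonlinearWave γ (-1) Up WL α₁ β₁ V ∧ 0 ≤ α₁ ∧
    IsNonlinearWave γ 1 WR U₁ α₃ β₃ V ∧ β₁ ≤ WL.u ∧ WL.u ≤ α₃ ∧
    (∀ ξ, 0 < ξ → ξ < α₁ → V ξ = Up) ∧ (∀ ξ, 0 < ξ → β₁ < ξ → ξ < WL.u → V ξ = WL) ∧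
    (∀ ξ, WL.u < ξ → ξ < α₃ → V ξ = WR) ∧ (∀ ξ, β₃ < ξ → V ξ = U₁)

theorem eventually_nhdsLT_zero {p : ℝ → Prop} {a : ℝ} (ha : a < 0)
    (h : ∀ x, a < x → x < 0 → p x) : ∀ᶠ x in 𝓝[<] (0 : ℝ), p x := by
  filter_upwards [Ioo_mem_nhdsLT ha] with x hx using h x hx.1 hx.2

theorem eventually_nhdsGT_zero {p : ℝ → Prop} {b : ℝ} (hb : 0 < b)
    (h : ∀ x, 0 < x → x < b → p x) : ∀ᶠ x in 𝓝[>] (0 : ℝ), p x := by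
  filter_upwards [Ioo_mem_nhdsGT hb] with x hx using h x hx.1 hx.2

/-- The limit at `0-` identifies `Um` with the piece of the profile next to `ξ = 0`. A `u - a` fan
there would make `Um` sonic, and a contact or `u + a` wave of negative speed contradicts `0 < Um.u`.
-/
theorem IsCRPSolution.leftHalf {γ : ℝ} (hγ : 1 < γ) {U₁ Um : GasState} {V : ℝ → GasState}
    (hm : Um.Physical) (hu : 0 < Um.u) (hs : Um.u ≠ soundSpeed γ Um)
    (h : IsCRPSolution γ U₁ Um V) (ht : TendstoState V (𝓝[<] 0) Um) : LeftHalf γ U₁ Um V := by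
  obtain ⟨WL, WR, α₁, β₁, α₃, β₃, pL, pR, w1, hWu, hp, w3, o1, o3, v1, v2, v3, v4⟩ := h
  have a0 := soundSpeed_pos hγ hm
  have c3 : 0 < charSpeed γ 1 Um := by rw [charSpeed]; linarith
  rcases le_or_gt 0 α₁ with h1 | h1
  · have e : Um = U₁ := ht.eq_of_eventually
      (eventually_nhdsLT_zero neg_one_lt_zero fun x _ hx => v1 x (by linarith))
    refine ⟨-1, -1, Or.inl ⟨rfl, e.symm⟩, neg_one_lt_zero, fun ξ hξ => v1 ξ (by linarith),
      fun ξ _ hξ => by rw [e]; exact v1 ξ (by linarith)⟩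
  rcases le_or_gt 0 β₁ with h2 | h2
  · exfalso
    rcases w1 with ⟨e, -⟩ | ⟨e, -⟩ | ⟨-, -, -, -, w⟩
    · linarith
    · linarith
    · have := ht.charSpeed_eq_zero (γ := γ) (σ := -1) nhdsWithin_le_nhds hm
        (eventually_nhdsLT_zero h1 fun x hx hx' => (w x ⟨hx, by linarith⟩).2.2)
      rw [charSpeed] at this
      exact hs (by linarith)
  rcases le_or_gt 0 WL.u with h3 | h3
  · have e : Um = WL := ht.eq_of_eventually
      (eventually_nhdsLT_zero h2 fun x hx hx' => v2 x hx (by linarith))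
    rw [← e] at w1
    exact ⟨α₁, β₁, w1, h2, v1, fun ξ hξ hξ' => by rw [e]; exact v2 ξ hξ (by linarith)⟩
  exfalso
  rcases le_or_gt 0 α₃ with h4 | h4
  · have e : Um = WR := ht.eq_of_eventually
      (eventually_nhdsLT_zero h3 fun x hx hx' => v3 x hx (by linarith))
    rw [hWu, ← e] at h3
    linarith
  rcases w3 with ⟨-, e⟩ | ⟨e, w⟩ | ⟨-, -, e, -, w⟩
  · rw [hWu, e] at h3; linarith
  · linarith [w.2.1]
  · rcases le_or_gt 0 β₃ with h5 | h5
    · exact c3.ne' (ht.charSpeed_eq_zero nhdsWithin_le_nhds hm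
        (eventually_nhdsLT_zero h4 fun x hx hx' => (w x ⟨hx, by linarith⟩).2.2))
    · linarith

theorem IsCRPSolution.rightHalf {γ : ℝ} (hγ : 1 < γ) {Up U₁ : GasState} {V : ℝ → GasState}
    (hP : Up.Physical) (hu : 0 < Up.u)
    (h : IsCRPSolution γ Up U₁ V) (ht : TendstoState V (𝓝[>] 0) Up) :
    ∃ WL WR, WL.Physical ∧ WR.Physical ∧ WL.u = WR.u ∧ WL.p = WR.p ∧
      RightHalf γ Up U₁ WL WR V := by
  obtain ⟨WL, WR, α₁, β₁, α₃, β₃, pL, pR, w1, hWu, hp, w3, o1, o3, v1, v2, v3, v4⟩ := h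
  refine ⟨WL, WR, pL, pR, hWu, hp, ?_⟩
  have a0 := soundSpeed_pos hγ hP
  have c3 : 0 < charSpeed γ 1 Up := by rw [charSpeed]; linarith
  rcases lt_or_ge 0 α₁ with h1 | h1
  · exact ⟨α₁, β₁, α₃, β₃, w1, h1.le, w3, o1, o3, fun ξ _ => v1 ξ, fun ξ _ => v2 ξ, v3, v4⟩
  rcases lt_or_ge 0 β₁ with h2 | h2
  -- A fan met at `ξ = 0+` makes `Up` sonic, so it starts exactly at `0`: this is the choked case.
  · have hα : 0 ≤ α₁ := by
      rcases w1 with ⟨e, -⟩ | ⟨e, -⟩ | ⟨-, e, -, -, w⟩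
      · linarith
      · linarith
      · rw [← e]
        exact (ht.charSpeed_eq_zero (γ := γ) (σ := -1) nhdsWithin_le_nhds hP
          (eventually_nhdsGT_zero h2 fun x hx hx' => (w x ⟨by linarith, hx'⟩).2.2)).ge
    exact ⟨α₁, β₁, α₃, β₃, w1, hα, w3, o1, o3, fun ξ _ => v1 ξ, fun ξ _ => v2 ξ, v3, v4⟩
  rcases lt_or_ge 0 WL.u with h3 | h3
  · have e : Up = WL := ht.eq_of_eventually
      (eventually_nhdsGT_zero h3 fun x hx hx' => v2 x (by linarith) hx')
    -- The `u - a` wave lies in `ξ ≤ 0`, outside the right half, and is replaced by an absent wave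
    -- at `0`.
    exact ⟨0, 0, α₃, β₃, Or.inl ⟨rfl, e⟩, le_rfl, w3, h3.le, o3,
      fun ξ h h' => absurd h h'.not_gt, fun ξ h _ => v2 ξ (by linarith), v3, v4⟩
  exfalso
  rcases lt_or_ge 0 α₃ with h4 | h4
  · have e : Up = WR := ht.eq_of_eventually
      (eventually_nhdsGT_zero h4 fun x hx hx' => v3 x (by linarith) hx')
    rw [hWu, ← e] at h3
    linarith
  rcases lt_or_ge 0 β₃ with h5 | h5
  · rcases w3 with ⟨e, -⟩ | ⟨e, -⟩ | ⟨-, -, -, -, w⟩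
    · linarith
    · linarith
    · exact c3.ne' (ht.charSpeed_eq_zero nhdsWithin_le_nhds hP
        (eventually_nhdsGT_zero h5 fun x hx hx' => (w x ⟨by linarith, hx'⟩).2.2))
  · have e : Up = U₁ := ht.eq_of_eventually
      (eventually_nhdsGT_zero one_pos fun x hx _ => v4 x (by linarith))
    rw [← e] at w3
    rcases w3 with ⟨-, e⟩ | ⟨e, w⟩ | ⟨-, -, e, -, w⟩
    · rw [hWu, e] at h3; linarith
    · linarith [w.2.1]
    · linarith

/-! ### Uniqueness of the profiles -/

/-- Two profiles of the left half agree except on the lines bounding the waves. -/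
theorem LeftHalf.finite_ne {γ : ℝ} (hγ : 1 < γ) {U₁ Um : GasState} (h₁ : U₁.Physical)
    (hm : Um.Physical) {V V' : ℝ → GasState} (h : LeftHalf γ U₁ Um V)
    (h' : LeftHalf γ U₁ Um V') : {ξ | ξ < 0 ∧ V ξ ≠ V' ξ}.Finite := by
  obtain ⟨α, β, w, -, v1, v2⟩ := h
  obtain ⟨α', β', w', -, v1', v2'⟩ := h'
  refine (Set.toFinite {α, β, α', β'}).subset fun ξ hξ => ?_
  obtain ⟨h0, hne⟩ := hξ
  by_contra hmem
  simp only [mem_insert_iff, mem_singleton_iff, not_or] at hmem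
  obtain ⟨n1, n2, n3, n4⟩ := hmem
  apply hne
  -- An absent wave has an arbitrary position, but then both profiles are constant on either side of
  -- it.
  rcases w.unique hγ h₁ hm w' with ⟨e, rfl, rfl⟩ | ⟨rfl, rfl, hV⟩
  · subst e
    have : V ξ = U₁ := by
      rcases lt_or_gt_of_ne n1 with h | h
      exacts [v1 ξ h, v2 ξ h h0]
    have : V' ξ = U₁ := by
      rcases lt_or_gt_of_ne n3 with h | h
      exacts [v1' ξ h, v2' ξ h h0]
    simp_all
  · rcases lt_or_gt_of_ne n1 with h | h
    · rw [v1 ξ h, v1' ξ h]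
    · rcases lt_or_gt_of_ne n2 with h2 | h2
      · exact hV ξ ⟨h, h2⟩
      · rw [v2 ξ h2 h0, v2' ξ h2 h0]

theorem IsNonlinearWave.unique_right {γ α β α' β' : ℝ} (hγ : 1 < γ) {U W : GasState}
    (hU : U.Physical) (hW : W.Physical) {V V' : ℝ → GasState}
    (h : IsNonlinearWave γ 1 U W α β V) (h' : IsNonlinearWave γ 1 U W α' β' V') :
    (U = W ∧ α = β ∧ α' = β') ∨
      (α = α' ∧ β = β' ∧ ∀ ξ ∈ Ioo α β, V ξ = V' ξ) := by
  rcases h.reflect.unique hγ hW.reflect hU.reflect h'.reflect with ⟨e, e1, e2⟩ | ⟨e1, e2, hV⟩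
  · exact Or.inl ⟨(GasState.reflect_injective e).symm, by linarith, by linarith⟩
  · refine Or.inr ⟨by linarith, by linarith, fun ξ hξ => ?_⟩
    have := hV (-ξ) ⟨by linarith [hξ.2], by linarith [hξ.1]⟩
    simpa [reflectProfile] using GasState.reflect_injective this

/-- Two profiles of the right half agree except on the lines bounding the waves. -/
theorem RightHalf.finite_ne {γ : ℝ} (hγ : 1 < γ) {Up U₁ WL WR : GasState} (h₁ : U₁.Physical)
    (hP : Up.Physical) (hL : WL.Physical) (hR : WR.Physical) {V V' : ℝ → GasState}
    (h : RightHalf γ Up U₁ WL WR V) (h' : RightHalf γ Up U₁ WL WR V') :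
    {ξ | 0 < ξ ∧ V ξ ≠ V' ξ}.Finite := by
  obtain ⟨α₁, β₁, α₃, β₃, w1, -, w3, o1, o3, v1, v2, v3, v4⟩ := h
  obtain ⟨α₁', β₁', α₃', β₃', w1', -, w3', o1', o3', v1', v2', v3', v4'⟩ := h'
  refine (Set.toFinite {α₁, β₁, α₃, β₃, α₁', β₁', α₃', β₃', WL.u}).subset fun ξ hξ => ?_
  obtain ⟨h0, hne⟩ := hξ
  by_contra hmem
  simp only [mem_insert_iff, mem_singleton_iff, not_or] at hmem
  obtain ⟨n1, n2, n3, n4, n1', n2', n3', n4', n5⟩ := hmem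
  apply hne
  rcases lt_or_gt_of_ne n5 with hc | hc
  · rcases w1.unique hγ hP hL w1' with ⟨e, rfl, rfl⟩ | ⟨rfl, rfl, hV⟩
    · subst e
      have : V ξ = Up := by
        rcases lt_or_gt_of_ne n1 with h | h
        exacts [v1 ξ h0 h, v2 ξ h0 h hc]
      have : V' ξ = Up := by
        rcases lt_or_gt_of_ne n1' with h | h
        exacts [v1' ξ h0 h, v2' ξ h0 h hc]
      simp_all
    · rcases lt_or_gt_of_ne n1 with h | h
      · rw [v1 ξ h0 h, v1' ξ h0 h]
      · rcases lt_or_gt_of_ne n2 with h2 | h2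
        · exact hV ξ ⟨h, h2⟩
        · rw [v2 ξ h0 h2 hc, v2' ξ h0 h2 hc]
  · rcases w3.unique_right hγ hR h₁ w3' with ⟨e, rfl, rfl⟩ | ⟨rfl, rfl, hV⟩
    · subst e
      have : V ξ = WR := by
        rcases lt_or_gt_of_ne n3 with h | h
        exacts [v3 ξ hc h, v4 ξ h]
      have : V' ξ = WR := by
        rcases lt_or_gt_of_ne n3' with h | h
        exacts [v3' ξ hc h, v4' ξ h]
      simp_all
    · rcases lt_or_gt_of_ne n3 with h | h
      · rw [v3 ξ hc h, v3' ξ hc h]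
      · rcases lt_or_gt_of_ne n4 with h2 | h2
        · exact hV ξ ⟨h, h2⟩
        · rw [v4 ξ h2, v4' ξ h2]

/-! ### Solutions with flow to the right at the heating point -/

/-- The states and profiles of a solution in which the gas flows to the right at the heating
point. -/
structure IsConfiguration (γ k : ℝ) (U₁ Um Up WL WR : GasState) (VL VR : ℝ → GasState) :
    Prop where
  physical_m : Um.Physical
  physical_p : Up.Physical
  physical_L : WL.Physical
  physical_R : WR.Physical
  velocity_pos : 0 < Um.u
  heats : Heats γ k Um Up
  subsonic : Um.u < soundSpeed γ Um → Up.u ≤ soundSpeed γ Up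
  supersonic : soundSpeed γ Um < Um.u → soundSpeed γ Up ≤ Up.u
  velocity_eq : WL.u = WR.u
  pressure_eq : WL.p = WR.p
  left : LeftHalf γ U₁ Um VL
  right : RightHalf γ Up U₁ WL WR VR

theorem abs_mach {γ : ℝ} (hγ : 1 < γ) {W : GasState} (hW : W.Physical) (hu : 0 < W.u) :
    (|mach γ W| < 1 ↔ W.u < soundSpeed γ W) ∧ (1 < |mach γ W| ↔ soundSpeed γ W < W.u) ∧
    (|mach γ W| ≤ 1 ↔ W.u ≤ soundSpeed γ W) ∧ (1 ≤ |mach γ W| ↔ soundSpeed γ W ≤ W.u) := by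
  have a0 := soundSpeed_pos hγ hW
  rw [mach, abs_of_pos (div_pos hu a0)]
  exact ⟨div_lt_one a0, one_lt_div a0, div_le_one a0, one_le_div a0⟩

theorem exists_isConfiguration {γ k : ℝ} (hγ : 1 < γ) (hk : 0 < k) {U₁ Um Up : GasState}
    {VL VR : ℝ → GasState} (hm : Um.Physical) (hP : Up.Physical)
    (hL : IsCRPSolution γ U₁ Um VL) (hR : IsCRPSolution γ Up U₁ VR)
    (tL : TendstoState VL (𝓝[<] 0) Um) (tR : TendstoState VR (𝓝[>] 0) Up)
    (hu : 0 < Um.u) (hh : Heats γ k Um Up) (hb : PhysicalBranch γ Um Up) :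
    ∃ WL WR, IsConfiguration γ k U₁ Um Up WL WR VL VR := by
  have hu' := hh.velocity_pos hm hP hu
  obtain ⟨WL, WR, pL, pR, e1, e2, hr⟩ := hR.rightHalf hγ hP hu' tR
  obtain ⟨m1, m2, -, -⟩ := abs_mach hγ hm hu
  obtain ⟨-, -, m3, m4⟩ := abs_mach hγ hP hu'
  exact ⟨WL, WR, hm, hP, pL, pR, hu, hh, fun h => m3.1 (hb.1 (m1.2 h)),
    fun h => m4.1 (hb.2 (m2.2 h)), e1, e2,
    hL.leftHalf hγ hm hu (hh.not_sonic hγ hk hm hP hu) tL, hr⟩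

namespace IsConfiguration

variable {γ k : ℝ} {U₁ Um Up WL WR Um' Up' WL' WR' : GasState} {VL VR VL' VR' : ℝ → GasState}

theorem curve_left (h : IsConfiguration γ k U₁ Um Up WL WR VL VR) : OnWaveCurve γ U₁ Um := by
  obtain ⟨α, β, w, -⟩ := h.left
  exact w.onWaveCurve

theorem curve_right (h : IsConfiguration γ k U₁ Um Up WL WR VL VR) :
    OnWaveCurve γ U₁.reflect WR.reflect := by
  obtain ⟨α₁, β₁, α₃, β₃, -, -, w, -⟩ := h.right
  exact w.reflect.onWaveCurve

theorem curve_middle (h : IsConfiguration γ k U₁ Um Up WL WR VL VR) : OnWaveCurve γ Up WL := by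
  obtain ⟨α₁, β₁, α₃, β₃, w, -⟩ := h.right
  exact w.onWaveCurve

/-- At a supersonic `Um` the speed `u - a` is positive, whereas a shock or fan ending at `Um` in `ξ
< 0` would force it to be negative. -/
theorem eq_of_supersonic (h : IsConfiguration γ k U₁ Um Up WL WR VL VR)
    (hs : soundSpeed γ Um < Um.u) : Um = U₁ := by
  obtain ⟨α, β, w, hβ, -⟩ := h.left
  have hc : 0 < charSpeed γ (-1) Um := by rw [charSpeed]; linarith
  rcases w with ⟨-, e⟩ | ⟨e, w⟩ | ⟨-, -, e, -⟩
  · exact e.symm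
  · linarith [w.2.1]
  · linarith

/-- Behind a subsonic heating point the flow may only expand further, and only if it is
choked. -/
theorem middle_of_subsonic (hγ : 1 < γ) (h : IsConfiguration γ k U₁ Um Up WL WR VL VR)
    (hs : Up.u ≤ soundSpeed γ Up) :
    (WL.p ≤ Up.p ∧ Up.u ≤ WL.u) ∧ (Up.u < soundSpeed γ Up → WL = Up) := by
  obtain ⟨α₁, β₁, α₃, β₃, w, hα, -⟩ := h.right
  have hc : charSpeed γ (-1) Up ≤ 0 := by rw [charSpeed]; linarith
  rcases w with ⟨-, e⟩ | ⟨e, w⟩ | ⟨hlt, e, e', w, -⟩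
  · subst e; exact ⟨⟨le_rfl, le_rfl⟩, fun _ => rfl⟩
  · linarith [w.2.2]
  · have := w.waveLT_of_charSpeed_lt hγ h.physical_p h.physical_L (by rw [e, e']; exact hlt)
    refine ⟨⟨this.1.le, this.2.1.le⟩, fun hs' => ?_⟩
    have hc' : charSpeed γ (-1) Up < 0 := by rw [charSpeed]; linarith
    linarith

/-- After reflection `WR` lies on a `u - a` curve, where the reflected velocity falls as pressure
rises; so pressure and true velocity rise together at the contact. -/
theorem right_lt (hγ : 1 < γ) (h₁ : U₁.Physical) (h : IsConfiguration γ k U₁ Um Up WL WR VL VR)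
    (h' : IsConfiguration γ k U₁ Um' Up' WL' WR' VL' VR') (hp : WL.p < WL'.p) : WL.u < WL'.u := by
  rw [h.pressure_eq, h'.pressure_eq] at hp
  rw [h.velocity_eq, h'.velocity_eq]
  rcases h.curve_right.trichotomy hγ h₁.reflect h.physical_R.reflect h'.physical_R.reflect
    h'.curve_right with hlt | heq | hlt
  · exact neg_lt_neg_iff.1 hlt.2.1
  · rw [GasState.reflect_injective heq] at hp; exact absurd hp (lt_irrefl _)
  · exact absurd hp hlt.1.not_gt

theorem right_lt_initial (hγ : 1 < γ) (h₁ : U₁.Physical)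
    (h : IsConfiguration γ k U₁ Um Up WL WR VL VR) :
    (WL.p < U₁.p → WL.u < U₁.u) ∧ (U₁.p < WL.p → U₁.u < WL.u) := by
  rw [h.pressure_eq, h.velocity_eq]
  rcases h.curve_right.trichotomy hγ h₁.reflect h.physical_R.reflect h₁.reflect (Or.inl rfl)
    with hlt | heq | hlt
  · exact ⟨fun _ => neg_lt_neg_iff.1 hlt.2.1, fun h => absurd h hlt.1.not_gt⟩
  · rw [GasState.reflect_injective heq]
    exact ⟨fun h => absurd h (lt_irrefl _), fun h => absurd h (lt_irrefl _)⟩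
  · exact ⟨fun h => absurd h hlt.1.not_gt, fun _ => neg_lt_neg_iff.1 hlt.2.1⟩

/-- The downstream Riemann problem has at most one solution. -/
theorem right_unique (hγ : 1 < γ) (h₁ : U₁.Physical)
    (h : IsConfiguration γ k U₁ Um Up WL WR VL VR)
    (h' : IsConfiguration γ k U₁ Um' Up WL' WR' VL' VR') : WL = WL' ∧ WR = WR' := by
  have hL : WL = WL' := by
    -- On the middle `u - a` curve velocity falls as pressure rises, while `right_lt` makes it rise.
    rcases h.curve_middle.trichotomy hγ h.physical_p h.physical_L h'.physical_L h'.curve_middle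
      with hlt | heq | hlt
    · exact absurd (h.right_lt hγ h₁ h' hlt.1) hlt.2.1.not_gt
    · exact heq
    · exact absurd (h'.right_lt hγ h₁ h hlt.1) hlt.2.1.not_gt
  refine ⟨hL, ?_⟩
  have hp : WR.p = WR'.p := by rw [← h.pressure_eq, ← h'.pressure_eq, hL]
  rcases h.curve_right.trichotomy hγ h₁.reflect h.physical_R.reflect h'.physical_R.reflect
    h'.curve_right with hlt | heq | hlt
  · exact absurd hp hlt.1.ne
  · exact GasState.reflect_injective heq
  · exact absurd hp hlt.1.ne'

/-- The higher state is not choked, so `WL' = Up'`. A choked expansion of the lower one only lowers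
its pressure and raises its velocity, so the opposite orders survive up to the contact and
contradict `right_lt`. -/
theorem not_waveLT (hγ : 1 < γ) (hk : 0 < k) (h₁ : U₁.Physical)
    (h : IsConfiguration γ k U₁ Um Up WL WR VL VR)
    (h' : IsConfiguration γ k U₁ Um' Up' WL' WR' VL' VR')
    (hs : Um.u < soundSpeed γ Um) (hs' : Um'.u < soundSpeed γ Um') : ¬ WaveLT γ Um Um' := by
  intro hlt
  have s := h.subsonic hs
  have s' := h'.subsonic hs'
  obtain ⟨hp, hu, hv⟩ := Heats.mono hγ hk h.physical_m h.physical_p h'.physical_m h'.physical_p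
    h'.velocity_pos h.heats h'.heats hlt hs s s'
  obtain ⟨⟨m1, m2⟩, -⟩ := h.middle_of_subsonic hγ s
  have e := (h'.middle_of_subsonic hγ s').2 hv
  have := h.right_lt hγ h₁ h' (by rw [e]; linarith)
  rw [e] at this
  linarith

/-- Subsonic and supersonic heating cannot occur for the same initial state: a solution with
subsonic heating would contain a shock moving to the left, and hence be too slow and of too high
a pressure downstream in comparison with the standing shock. -/
theorem not_subsonic_and_supersonic (hγ : 1 < γ) (hk : 0 < k) (h₁ : U₁.Physical)
    (h : IsConfiguration γ k U₁ Um Up WL WR VL VR)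
    (h' : IsConfiguration γ k U₁ Um' Up' WL' WR' VL' VR')
    (hs : Um.u < soundSpeed γ Um) (hs' : soundSpeed γ Um' < Um'.u) : False := by
  obtain rfl := h'.eq_of_supersonic hs'
  have hc : 0 < charSpeed γ (-1) Um' := by rw [charSpeed]; linarith
  obtain ⟨s, hs0, sh⟩ : ∃ s < 0, IsShock γ (-1) s Um' Um := by
    obtain ⟨α, β, w, hβ, -⟩ := h.left
    rcases w with ⟨-, e⟩ | ⟨e, w⟩ | ⟨e, e1, -⟩
    · subst e; exact absurd hs hs'.not_gt
    · exact ⟨α, by linarith, w⟩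
    · linarith
  obtain ⟨Un, pn, fn, un, -, -, sn⟩ := exists_conjugate hγ h₁ hs'.le
  obtain ⟨Vn, qn, gn, vn, hvn, tn, -⟩ :=
    exists_conjugate hγ h'.physical_p (h'.supersonic hs')
  -- `Heats` involves only fluxes, so it passes to the conjugate states.
  have hn : Heats γ k Un Vn := by rw [Heats, gn, fn]; exact h'.heats
  have shn : IsShock γ (-1) 0 Um' Un := by
    refine ⟨by rw [fn, sub_self, zero_smul], ?_, hc⟩
    rw [charSpeed]; linarith [sn hs']
  have hlt := shn.waveLT hγ h₁ pn h.physical_m sh hs0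
  obtain ⟨hp, hu, hv⟩ := Heats.mono hγ hk pn qn h.physical_m h.physical_p h.velocity_pos hn
    h.heats hlt (sn hs') tn (h.subsonic hs)
  have hvel : Vn.u < Um'.u :=
    hvn.trans_lt (h'.heats.velocity_lt hγ hk h₁ h'.physical_p h'.velocity_pos hs'
      (h'.supersonic hs'))
  -- Mass and momentum fluxes are those of `Um'`, so the loss of velocity is a gain of pressure.
  have hpress : Um'.p < Vn.p := by
    have f := gn.trans h'.heats
    have f0 := congrFun f 0
    have f1 := congrFun f 1
    simp only [flux, Pi.add_apply, Matrix.cons_val, add_zero] at f0 f1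
    have : Vn.p - Um'.p = Um'.ρ * Um'.u * (Um'.u - Vn.u) := by
      linear_combination f1 - Vn.u * f0
    have := mul_pos (mul_pos h₁.1 h'.velocity_pos) (sub_pos.2 hvel)
    linarith
  have e := (h.middle_of_subsonic hγ (h.subsonic hs)).2 hv
  have := (h.right_lt_initial hγ h₁).2 (by rw [e]; linarith)
  rw [e] at this
  linarith

theorem unique (hγ : 1 < γ) (hk : 0 < k) (h₁ : U₁.Physical)
    (h : IsConfiguration γ k U₁ Um Up WL WR VL VR)
    (h' : IsConfiguration γ k U₁ Um' Up' WL' WR' VL' VR') :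
    Um = Um' ∧ Up = Up' ∧ WL = WL' ∧ WR = WR' := by
  have key : Um = Um' ∧ Up = Up' := by
    have ns := h.heats.not_sonic hγ hk h.physical_m h.physical_p h.velocity_pos
    have ns' := h'.heats.not_sonic hγ hk h'.physical_m h'.physical_p h'.velocity_pos
    rcases lt_or_gt_of_ne ns with hs | hs <;> rcases lt_or_gt_of_ne ns' with hs' | hs'
    · have e : Um = Um' := by
        rcases h.curve_left.trichotomy hγ h₁ h.physical_m h'.physical_m h'.curve_left
          with hlt | heq | hlt
        · exact absurd hlt (h.not_waveLT hγ hk h₁ h' hs hs')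
        · exact heq
        · exact absurd hlt (h'.not_waveLT hγ hk h₁ h hs' hs)
      have hh := h'.heats
      rw [← e] at hh
      exact ⟨e, h.heats.unique hγ h.physical_m h.physical_p h'.physical_p h.velocity_pos hh
        (Or.inl ⟨h.subsonic hs, h'.subsonic hs'⟩)⟩
    · exact (h.not_subsonic_and_supersonic hγ hk h₁ h' hs hs').elim
    · exact (h'.not_subsonic_and_supersonic hγ hk h₁ h hs' hs).elim
    · have e : Um = Um' := (h.eq_of_supersonic hs).trans (h'.eq_of_supersonic hs').symm
      have hh := h'.heats
      rw [← e] at hh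
      exact ⟨e, h.heats.unique hγ h.physical_m h.physical_p h'.physical_p h.velocity_pos hh
        (Or.inr ⟨h.supersonic hs, h'.supersonic hs'⟩)⟩
  obtain ⟨rfl, rfl⟩ := key
  exact ⟨rfl, rfl, h.right_unique hγ h₁ h'⟩

/-- The gas does not flow through the heating point against the direction of the initial
velocity. -/
theorem initial_velocity_nonneg (hγ : 1 < γ) (hk : 0 < k) (h₁ : U₁.Physical)
    (h : IsConfiguration γ k U₁ Um Up WL WR VL VR) : 0 ≤ U₁.u := by
  by_contra hneg
  push Not at hneg
  have hu := h.velocity_pos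
  have hs : Um.u < soundSpeed γ Um := by
    refine lt_of_le_of_ne (not_lt.1 fun hs => ?_)
      (h.heats.not_sonic hγ hk h.physical_m h.physical_p hu)
    rw [h.eq_of_supersonic hs] at hu
    linarith
  have hup := h.heats.velocity_pos h.physical_m h.physical_p hu
  have hp := h.heats.pressure_lt hγ hk h.physical_m h.physical_p hu hs (h.subsonic hs)
  obtain ⟨⟨m1, m2⟩, -⟩ := h.middle_of_subsonic hγ (h.subsonic hs)
  -- Speeding up from `U₁.u < 0` to `Um.u > 0` takes a rarefaction. Heating and a choked expansion
  -- lower the pressure further, so the `u + a` curve gives `WL.u < U₁.u < 0`, although `WL.u ≥ Up.u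
  -- > 0`.
  have hpm : Um.p < U₁.p := by
    rcases h.curve_left.trichotomy hγ h₁ h.physical_m h₁ (Or.inl rfl) with hlt | heq | hlt
    · exact hlt.1
    · rw [heq] at hu; linarith
    · linarith [hlt.2.1]
  have := (h.right_lt_initial hγ h₁).1 (by linarith)
  linarith

end IsConfiguration

/-! ### Uniqueness -/

/-- The denominator in the heating parameter is the upstream energy flux itself, so `Q = k * flux γ
U 2`, as in `Heats`. -/
theorem energy_flux_eq_totalEnthalpy {γ : ℝ} (hγ : 1 < γ) {W : GasState} (hW : W.Physical) :
    flux γ W 2 = W.ρ * W.u * totalEnthalpy γ W := by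
  have h1 : γ - 1 ≠ 0 := by linarith
  have h2 := hW.1.ne'
  simp only [flux, Matrix.cons_val, totalEnergy, totalEnthalpy, enthalpy]
  field_simp
  ring

theorem totalEnthalpy_pos {γ : ℝ} (hγ : 1 < γ) {W : GasState} (hW : W.Physical) :
    0 < totalEnthalpy γ W := by
  have h1 : 0 < γ - 1 := by linarith
  have h2 := hW.1
  have h3 := hW.2
  rw [totalEnthalpy, enthalpy]; positivity

theorem IsDoubleCRPSolution.exists_isConfiguration {γ k : ℝ} (hγ : 1 < γ) (hk : 0 < k)
    {U₁ : GasState} (h₁ : U₁.Physical) (hu₁ : 0 < U₁.u) {U : ℝ → ℝ → GasState}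
    (h : IsDoubleCRPSolution γ k U₁ U) :
    ∃ Um Up WL WR VL VR, IsConfiguration γ k U₁ Um Up WL WR VL VR ∧
      (∀ t, 0 < t → ∀ x, x < 0 → U x t = VL (x / t)) ∧
      (∀ t, 0 < t → ∀ x, 0 < x → U x t = VR (x / t)) := by
  obtain ⟨-, Um, Up, VL, VR, hm, hP, cL, cR, uL, uR, tL, tR, hne, hne', Q, hQ, hf, hh⟩ := h
  have tL' : TendstoState VL (𝓝[<] 0) Um := (tL 1 one_pos).congr' (by
    filter_upwards [self_mem_nhdsWithin] with x hx
    simpa using uL 1 one_pos x hx)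
  have tR' : TendstoState VR (𝓝[>] 0) Up := (tR 1 one_pos).congr' (by
    filter_upwards [self_mem_nhdsWithin] with x hx
    simpa using uR 1 one_pos x hx)
  rcases hh with ⟨hu, hkQ, hb⟩ | ⟨hu, hkQ, hb⟩
  · have hheat : Heats γ k Um Up := by
      rw [abs_of_pos hu, ← energy_flux_eq_totalEnthalpy hγ hm] at hkQ
      have : flux γ Um 2 ≠ 0 := by
        rw [energy_flux_eq_totalEnthalpy hγ hm]
        exact (mul_pos (mul_pos hm.1 hu) (totalEnthalpy_pos hγ hm)).ne'
      rw [Heats, hkQ, div_mul_cancel₀ _ this, hf]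
    obtain ⟨WL, WR, hc⟩ := HeatedEuler.exists_isConfiguration hγ hk hm hP cL cR tL' tR' hu hheat hb
    exact ⟨Um, Up, WL, WR, VL, VR, hc, uL, uR⟩
  -- Flow to the left becomes, after reflection, flow to the right with initial velocity `-U₁.u <
  -- 0`.
  · exfalso
    have hup : Up.u < 0 := by
      have f0 := congrFun hf 0
      simp only [flux, Pi.add_apply, Matrix.cons_val, add_zero] at f0
      have := mul_neg_of_pos_of_neg hm.1 hu
      rw [← f0] at this
      exact (pos_iff_neg_of_mul_neg this).1 hP.1
    have hheat : Heats γ k Up.reflect Um.reflect := by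
      have e : Up.ρ * |Up.u| * totalEnthalpy γ Up = flux γ Up.reflect 2 := by
        rw [energy_flux_eq_totalEnthalpy hγ hP.reflect, abs_of_neg hup]
        simp [GasState.reflect, totalEnthalpy, enthalpy]
      have : flux γ Up.reflect 2 ≠ 0 := by
        rw [← e]
        exact (mul_pos (mul_pos hP.1 (abs_pos.2 hne')) (totalEnthalpy_pos hγ hP)).ne'
      rw [e] at hkQ
      rw [Heats, hkQ, div_mul_cancel₀ _ this, flux_reflect, flux_reflect, hf]
      funext i
      fin_cases i <;> simp
    have hb' : PhysicalBranch γ Up.reflect Um.reflect := by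
      simpa only [PhysicalBranch, mach_reflect, abs_neg] using hb
    obtain ⟨WL, WR, hc⟩ := HeatedEuler.exists_isConfiguration hγ hk hP.reflect hm.reflect
      cR.reflect cL.reflect tR'.reflect_right tL'.reflect_left
      (by simpa [GasState.reflect] using hup) hheat hb'
    have := hc.initial_velocity_nonneg hγ hk h₁.reflect
    simp only [GasState.reflect] at this
    linarith

/-- For a flow to the right there is at most one solution under the double CRPs frame, whatever
the heating parameter: no condition on the roots of `Y` is needed. -/
theorem uniqueSolution {γ k : ℝ} (hγ : 1 < γ) (hk : 0 < k) {U₁ : GasState} (h₁ : U₁.Physical)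
    (hu₁ : 0 < U₁.u) : UniqueSolution γ k U₁ := by
  intro U U' h h' t ht
  rcases ht.eq_or_lt with rfl | ht
  · have : {x : ℝ | U x 0 ≠ U' x 0} = ∅ := by
      ext x; simp [h.1 x, h'.1 x]
    rw [this]; exact Set.finite_empty
  obtain ⟨Um, Up, WL, WR, VL, VR, c, uL, uR⟩ := h.exists_isConfiguration hγ hk h₁ hu₁
  obtain ⟨Um', Up', WL', WR', VL', VR', c', uL', uR'⟩ := h'.exists_isConfiguration hγ hk h₁ hu₁
  obtain ⟨rfl, rfl, rfl, rfl⟩ := c.unique hγ hk h₁ c'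
  have fL := c.left.finite_ne hγ h₁ c.physical_m c'.left
  have fR := c.right.finite_ne hγ h₁ c.physical_p c.physical_L c.physical_R c'.right
  -- Exceptional rays `ξ` meet time `t` at `x = ξ t`; the point `x = 0`, where the value is free, is
  -- added.
  refine (((fL.union fR).image (· * t)).union (Set.finite_singleton 0)).subset fun x hx => ?_
  have hxt : x / t * t = x := div_mul_cancel₀ x ht.ne'
  rcases lt_trichotomy x 0 with h0 | h0 | h0
  · refine Or.inl ⟨x / t, Or.inl ⟨div_neg_of_neg_of_pos h0 ht, ?_⟩, hxt⟩
    rw [← uL t ht x h0, ← uL' t ht x h0]; exact hx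
  · exact Or.inr h0
  · refine Or.inl ⟨x / t, Or.inr ⟨div_pos h0 ht, ?_⟩, hxt⟩
    rw [← uR t ht x h0, ← uR' t ht x h0]; exact hx

end HeatedEuler

theorem mainTheorem2 (γ k : ℝ) (hγ : 1 < γ) (hγ' : γ ≤ 3) (hk : 0 < k) :
    (1 ≤ k * (γ ^ 2 - 1) →
      ∀ U₁ : HeatedEuler.GasState, U₁.Physical → 0 < U₁.u →
        HeatedEuler.UniqueSolution γ k U₁) ∧
    (k * (γ ^ 2 - 1) < 1 →
      (∀ M : ℝ, HeatedEuler.Mstar γ k ≤ M → HeatedEuler.Y γ k M = 0 →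
        M ≤ HeatedEuler.Mstarstar γ k) →
      ∀ U₁ : HeatedEuler.GasState, U₁.Physical → 0 < U₁.u →
        HeatedEuler.UniqueSolution γ k U₁) := by
  exact ⟨fun _ _ h₁ hu => HeatedEuler.uniqueSolution hγ hk h₁ hu,
    fun _ _ _ h₁ hu => HeatedEuler.uniqueSolution hγ hk h₁ hu⟩
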